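/- A *semimetric* on a set $X$ is a non-negative real function $\rho$ on $X\times X$ that is symmetric, vanishes on the diagonal and satisfies the triangle inequality. A *semimetric triple* $(X,\mu,\rho)$ is a standard probability space $(X,\mu)$ (atoms are allowed) with a semimetric $\rho$ that is measurable on $(X^2,\mu^2)$. It is *admissible* if there is a set $X_0\subset X$ with $\mu(X_0)=1$ such that $(X_0,\rho)$ is separable, and *summable* if $\int_{X^2}\rho\,d\mu^2<\infty$. For $\varepsilon\in(0,1)$ the *$\varepsilon$-entropy* $\mathbb H_\varepsilon(X,\mu,\rho)$ is $\log k$, where $k\in\mathbb N\cup\{\infty\}$ is the minimal number for which $X=X_0\cup X_1\cup\dots\cup X_k$ with measurable sets such that $\mu(X_0)<\varepsilon$ and $\operatorname{diam}_\rho(X_j)<\varepsilon$ for $j=1,\dots,k$; for $\varepsilon\ge 1$ put $\mathbb H_\varepsilon(X,\mu,\rho)=0$. For a function $f$ on $(X^2,\mu^2)$ let $$\|f\|_m=\inf\Big\{\int_{X^2}D\,d\mu^2 \;:\; D\text{ is a measurable semimetric on }(X,\mu),\ |f|\le D\ \ \mu^2\text{-a.e.}\Big\}.$$ For two semimetric triples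 define $$\mathrm{Dist}_m\big((X_1,\mu_1,\rho_1),(X_2,\mu_2,\rho_2)\big)=\inf\big\|\rho_1\circ\psi_1-\rho_2\circ\psi_2\big\|_m ,$$ where $\rho_i\circ\psi_i$ denotes $(x,y)\mapsto\rho_i(\psi_i(x),\psi_i(y))$ and the infimum is over all standard probability spaces $(X,\mu)$ with measure-preserving maps $\psi_i\colon(X,\mu)\to(X_i,\mu_i)$, $i=1,2$; and $$\mathrm{Dist}_K\big((X_1,\mu_1,\rho_1),(X_2,\mu_2,\rho_2)\big)=\inf d_K\big(\phi_1(\mu_1),\phi_2(\mu_2)\big),$$ where the infimum is over all semimetric spaces $(Y,\rho)$ (with the Borel $\sigma$-algebra) and distance-preserving, almost everywhere measurable maps $\phi_i\colon(X_i,\rho_i)\to(Y,\rho)$ (for admissible $\rho_i$ the measurability is automatic), $\phi_i(\mu_i)$ is the image measure, and $d_K(\nu_1,\nu_2)=\inf_\gamma\int_{Y\times Y}\rho\,d\gamma$ over all measures $\gamma$ on $Y\times Y$ with marginals $\nu_1,\nu_2$ is the Kantorovich distance. A set of triples is *precompact* with respect to one of these distances if for every $\varepsilon>0$ it contains a finite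 $\varepsilon$-net. **Theorem.** Let $M=\{(X_i,\mu_i,\rho_i): i\in I\}$ be a set of summable admissible semimetric triples. Then $M$ is precompact with respect to $\mathrm{Dist}_m$ if and only if the following two conditions hold: 1. the semimetrics $\rho_i$ are uniformly integrable: $$\lim_{R\to\infty}\ \sup_{i\in I}\int_{\{\rho_i>R\}}\rho_i\,d\mu_i^2=0;$$ 2. for every $\varepsilon>0$ the $\varepsilon$-entropies are uniformly bounded: $$\sup_{i\in I}\mathbb H_\varepsilon(X_i,\mu_i,\rho_i)<\infty .$$ Likewise, $M$ is precompact with respect to $\mathrm{Dist}_K$ if and only if conditions 1 and 2 hold. -/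

import Mathlib

open MeasureTheory Filter Topology
open scoped ENNReal

universe u v

/-- A semimetric (pseudometric): a non-negative symmetric function of two variables that vanishes
on the diagonal and satisfies the triangle inequality. -/
structure IsSemimetric {X : Type u} (ρ : X → X → ℝ) : Prop where
  nonneg : ∀ x y, 0 ≤ ρ x y
  self : ∀ x, ρ x x = 0
  symm : ∀ x y, ρ x y = ρ y x
  triangle : ∀ x y z, ρ x z ≤ ρ x y + ρ y z

/-- A measurable semimetric on `(X, μ)`: a semimetric that is measurable as a function on
`(X × X, μ × μ)`. The square carries its completed sigma-algebra, and for that sigma-algebra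
measurability of a real function is `AEMeasurable`. -/
structure IsMeasurableSemimetric {X : Type u} [MeasurableSpace X] (μ : Measure X)
    (ρ : X → X → ℝ) : Prop where
  semimetric : IsSemimetric ρ
  aemeasurable : AEMeasurable (fun p : X × X => ρ p.1 p.2) (μ.prod μ)

/-- A semimetric triple: a standard probability space (atoms are allowed) with a measurable
semimetric. -/
structure SemimetricTriple where
  carrier : Type u
  [measurableSpace : MeasurableSpace carrier]
  [standardBorel : StandardBorelSpace carrier]
  measure : Measure carrier
  [isProbability : IsProbabilityMeasure measure]
  dist : carrier → carrier → ℝ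
  measurableSemimetric : IsMeasurableSemimetric measure dist

namespace SemimetricTriple

attribute [instance] measurableSpace standardBorel isProbability

/-- The semimetric is separable on a subset of full measure. -/
def Admissible (T : SemimetricTriple.{u}) : Prop :=
  ∃ X₀ : Set T.carrier, T.measure X₀ᶜ = 0 ∧
    ∃ D : Set T.carrier, D.Countable ∧ D ⊆ X₀ ∧
      ∀ x ∈ X₀, ∀ ε : ℝ, 0 < ε → ∃ d ∈ D, T.dist x d < ε

/-- The semimetric has a finite integral over the square of the space. -/
def Summable (T : SemimetricTriple.{u}) : Prop :=
  Integrable (fun p : T.carrier × T.carrier => T.dist p.1 p.2) (T.measure.prod T.measure)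

end SemimetricTriple

/-- The diameter of a set `A` in the semimetric `ρ`. -/
noncomputable def semimetricDiam {X : Type u} (ρ : X → X → ℝ) (A : Set X) : ℝ≥0∞ :=
  ⨆ x ∈ A, ⨆ y ∈ A, ENNReal.ofReal (ρ x y)

/-- `X` is the union of `k + 1` measurable sets `X₀, X₁, …, X_k` (measurable for the completion of
`μ`), the first one of measure less than `ε`, the others of `ρ`-diameter less than `ε`. -/
def HasEpsCover {X : Type u} [MeasurableSpace X] (μ : Measure X) (ρ : X → X → ℝ) (ε : ℝ)
    (k : ℕ) : Prop :=
  ∃ (X₀ : Set X) (A : Fin k → Set X),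
    NullMeasurableSet X₀ μ ∧ (∀ j, NullMeasurableSet (A j) μ) ∧
    X₀ ∪ (⋃ j, A j) = Set.univ ∧
    μ X₀ < ENNReal.ofReal ε ∧ ∀ j, semimetricDiam ρ (A j) < ENNReal.ofReal ε

/-- The minimal `k` (or infinity) for which `HasEpsCover μ ρ ε k` holds. -/
noncomputable def epsCoverNumber {X : Type u} [MeasurableSpace X] (μ : Measure X)
    (ρ : X → X → ℝ) (ε : ℝ) : ℕ∞ :=
  ⨅ (k : ℕ) (_ : HasEpsCover μ ρ ε k), (k : ℕ∞)

open Classical in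
/-- The `ε`-entropy: the logarithm of the minimal number `k`, and `0` for `ε ≥ 1`. -/
noncomputable def epsEntropy {X : Type u} [MeasurableSpace X] (μ : Measure X)
    (ρ : X → X → ℝ) (ε : ℝ) : EReal :=
  if 1 ≤ ε then 0 else ENNReal.log ((epsCoverNumber μ ρ ε : ℕ∞) : ℝ≥0∞)

/-- The m-norm of a function `f` of two variables: the infimum of the integrals of the measurable
semimetrics that dominate `|f|` almost everywhere. -/
noncomputable def mNorm {X : Type u} [MeasurableSpace X] (μ : Measure X) (f : X → X → ℝ) : ℝ≥0∞ :=
  sInf {c | ∃ D : X → X → ℝ, IsMeasurableSemimetric μ D ∧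
    (∀ᵐ p ∂(μ.prod μ), |f p.1 p.2| ≤ D p.1 p.2) ∧
    c = ∫⁻ p, ENNReal.ofReal (D p.1 p.2) ∂(μ.prod μ)}

/-- The distance `Dist_m`: the infimum, over all couplings, that is, standard probability spaces
`(X, μ)` with measure-preserving maps `ψ₁`, `ψ₂` to the two spaces, of the m-norm of the difference
of the two semimetrics pulled back to `X`. -/
noncomputable def distM (T₁ T₂ : SemimetricTriple.{u}) : ℝ≥0∞ :=
  sInf {c | ∃ (X : Type u) (_ : MeasurableSpace X) (_ : StandardBorelSpace X)
    (μ : Measure X) (_ : IsProbabilityMeasure μ)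
    (ψ₁ : X → T₁.carrier) (ψ₂ : X → T₂.carrier),
    MeasurePreserving ψ₁ μ T₁.measure ∧ MeasurePreserving ψ₂ μ T₂.measure ∧
    c = mNorm μ (fun x y => T₁.dist (ψ₁ x) (ψ₁ y) - T₂.dist (ψ₂ x) (ψ₂ y))}

/-- The Kantorovich distance between two measures on a semimetric space: the infimum of the
transport cost over all transport plans. -/
noncomputable def kantorovichDist {Y : Type u} [PseudoMetricSpace Y] [MeasurableSpace Y]
    (ν₁ ν₂ : Measure Y) : ℝ≥0∞ :=
  sInf {c | ∃ γ : Measure (Y × Y), γ.map Prod.fst = ν₁ ∧ γ.map Prod.snd = ν₂ ∧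
    c = ∫⁻ p, edist p.1 p.2 ∂γ}

/-- The distance `Dist_K`: the infimum, over all isometric embeddings of the two spaces into a
common semimetric space `Y` with its Borel sigma-algebra, of the Kantorovich distance between the
images of the two measures. For admissible triples isometric embeddings are automatically
almost everywhere measurable; in general this is what makes the image measures meaningful. -/
noncomputable def distK (T₁ T₂ : SemimetricTriple.{u}) : ℝ≥0∞ :=
  sInf {c | ∃ (Y : Type u) (_ : PseudoMetricSpace Y) (_ : MeasurableSpace Y) (_ : BorelSpace Y)
    (φ₁ : T₁.carrier → Y) (φ₂ : T₂.carrier → Y),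
    (∀ x y, dist (φ₁ x) (φ₁ y) = T₁.dist x y) ∧ (∀ x y, dist (φ₂ x) (φ₂ y) = T₂.dist x y) ∧
    AEMeasurable φ₁ T₁.measure ∧ AEMeasurable φ₂ T₂.measure ∧
    c = kantorovichDist (T₁.measure.map φ₁) (T₂.measure.map φ₂)}

/-- A set is precompact (totally bounded) for the distance `d`: it contains, for every `ε > 0`, a
finite `ε`-net. -/
def IsPrecompactFor {S : Type v} (d : S → S → ℝ≥0∞) (M : Set S) : Prop :=
  ∀ ε : ℝ, 0 < ε → ∃ F : Set S, F.Finite ∧ F ⊆ M ∧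
    ∀ t ∈ M, ∃ s ∈ F, d t s < ENNReal.ofReal ε

/-- The semimetrics of the family are uniformly integrable:
`sup_i ∫_{ρ_i > R} ρ_i dμ_i²` tends to `0` as `R → ∞`. -/
def UniformlyIntegrableFamily {I : Type v} (T : I → SemimetricTriple.{u}) : Prop :=
  Tendsto (fun R : ℝ => ⨆ i, ∫⁻ p in {p : (T i).carrier × (T i).carrier | R < (T i).dist p.1 p.2},
      ENNReal.ofReal ((T i).dist p.1 p.2) ∂((T i).measure.prod (T i).measure))
    atTop (𝓝 0)

/-- For every `ε > 0` the `ε`-entropies of the triples of the family are uniformly bounded. -/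
def UniformlyBoundedEntropy {I : Type v} (T : I → SemimetricTriple.{u}) : Prop :=
  ∀ ε : ℝ, 0 < ε → (⨆ i, epsEntropy (T i).measure (T i).dist ε) < ⊤

/-! Necessity. Both conditions are stable under small perturbations in either distance and hold for
each single triple, so they pass from a finite net to the whole family. Uniform integrability is
measured by `tail`, the integral of `(ρ - R)⁺`. Since `t ↦ (t - R)⁺` is 1-Lipschitz, a tail changes
by at most twice the distance between the triples (`tail_le_of_distM_lt`, `tail_le_of_distK_lt`).
Covers are transferred by Markov's inequality: if the distance is below `(ε/16)²`, then off a set of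
measure `ε/16` the error is below `ε/16`, and an `ε/4`-cover of one triple yields an `ε`-cover of
the other with equally many pieces (`HasEpsCover.of_distM_lt`, `HasEpsCover.of_distK_lt`).

Sufficiency. The two conditions give every triple a `Discretization` with a common number of pieces
and a common bound `K` on the distances between centers. Its remainder is small, and the integral
over it of the distance to one center is small as well. The masses of the pieces and the distances
between centers form a vector in a fixed cube, so finitely many triples approximate all of these
vectors.

Two triples with close vectors are close. A coupling matches pieces with equal labels up to a small
mass (`exists_coupling_of_labels`), and gluing each center to its counterpart by a bridge of length
`δ` defines a cross distance `f` between the two spaces (`isCrossDist_iInf`). Its integral over the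
coupling is at most `6δ`. It bounds `distK` directly, through the disjoint union, and half of
`distM`, through the semimetric `f(p) + f(q)` on the coupling space. -/

namespace SemimetricTriple

/-- The semimetric of a triple as a pseudometric structure on its carrier. -/
abbrev toPseudoMetricSpace (T : SemimetricTriple.{u}) : PseudoMetricSpace T.carrier where
  dist := T.dist
  dist_self := T.measurableSemimetric.semimetric.self
  dist_comm := T.measurableSemimetric.semimetric.symm
  dist_triangle := T.measurableSemimetric.semimetric.triangle

/-! ### Truncated integrals and uniform integrability. -/

/-- The integral of the part of the semimetric above the level `R`. -/
noncomputable def tail (T : SemimetricTriple.{u}) (R : ℝ) : ℝ≥0∞ :=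
  ∫⁻ p, (ENNReal.ofReal (T.dist p.1 p.2) - ENNReal.ofReal R) ∂(T.measure.prod T.measure)

lemma aemeasurable_ofReal_dist (T : SemimetricTriple.{u}) :
    AEMeasurable (fun p : T.carrier × T.carrier => ENNReal.ofReal (T.dist p.1 p.2))
      (T.measure.prod T.measure) :=
  T.measurableSemimetric.aemeasurable.ennreal_ofReal

lemma Summable.eventually_tail_le {T : SemimetricTriple.{u}} (h : T.Summable) {ε : ℝ≥0∞}
    (hε : 0 < ε) : ∀ᶠ R in atTop, T.tail R ≤ ε := by
  have hfin : ∫⁻ p, ENNReal.ofReal (T.dist p.1 p.2) ∂(T.measure.prod T.measure) ≠ ∞ :=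
    h.lintegral_lt_top.ne
  have key : Tendsto (fun R => T.tail R) atTop
      (𝓝 (∫⁻ _p : T.carrier × T.carrier, 0 ∂(T.measure.prod T.measure))) := by
    refine tendsto_lintegral_filter_of_dominated_convergence'
      (fun p => ENNReal.ofReal (T.dist p.1 p.2)) ?_ ?_ hfin ?_
    · exact .of_forall fun R => T.aemeasurable_ofReal_dist.sub aemeasurable_const
    · exact .of_forall fun R => .of_forall fun p => tsub_le_self
    · refine .of_forall fun p => tendsto_const_nhds.congr' ?_
      filter_upwards [eventually_ge_atTop (T.dist p.1 p.2)] with R hR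
      exact (tsub_eq_zero_of_le (ENNReal.ofReal_le_ofReal hR)).symm
  rw [lintegral_zero] at key
  exact key.eventually_le_const hε

/-- Where `ρ > 2R`, one has `ρ ≤ 2(ρ - R)`. Together with `tail_le_setLIntegral` this lets tails,
which are stable under perturbation, replace integrals over superlevel sets, which are not. -/
lemma setLIntegral_le_two_mul_tail (T : SemimetricTriple.{u}) {R R' : ℝ} (hR : 0 ≤ R)
    (hR' : 2 * R ≤ R') :
    ∫⁻ p in {p : T.carrier × T.carrier | R' < T.dist p.1 p.2},
      ENNReal.ofReal (T.dist p.1 p.2) ∂(T.measure.prod T.measure) ≤ 2 * T.tail R := by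
  have hm : NullMeasurableSet {p : T.carrier × T.carrier | R' < T.dist p.1 p.2}
      (T.measure.prod T.measure) :=
    nullMeasurableSet_lt aemeasurable_const T.measurableSemimetric.aemeasurable
  have h2 : 2 * T.tail R = ∫⁻ p, 2 * (ENNReal.ofReal (T.dist p.1 p.2) - ENNReal.ofReal R)
      ∂(T.measure.prod T.measure) :=
    (lintegral_const_mul'' _ (T.aemeasurable_ofReal_dist.sub aemeasurable_const)).symm
  rw [h2]
  refine le_trans ?_ (setLIntegral_le_lintegral {p : T.carrier × T.carrier |
    R' < T.dist p.1 p.2} _)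
  refine lintegral_mono_ae ?_
  filter_upwards [ae_restrict_mem₀ hm] with p hp
  have hp : R' < T.dist p.1 p.2 := hp
  rw [← ENNReal.ofReal_sub _ hR, show (2 : ℝ≥0∞) = ENNReal.ofReal 2 by simp,
    ← ENNReal.ofReal_mul (by norm_num)]
  exact ENNReal.ofReal_le_ofReal (by linarith)

lemma lintegral_le_tail_add (T : SemimetricTriple.{u}) (s : Set (T.carrier × T.carrier)) (R : ℝ) :
    ∫⁻ p in s, ENNReal.ofReal (T.dist p.1 p.2) ∂(T.measure.prod T.measure) ≤
      T.tail R + ENNReal.ofReal R * (T.measure.prod T.measure) s := by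
  calc _ ≤ ∫⁻ p in s, ((ENNReal.ofReal (T.dist p.1 p.2) - ENNReal.ofReal R) + ENNReal.ofReal R)
        ∂(T.measure.prod T.measure) := lintegral_mono fun p => le_tsub_add
    _ = ∫⁻ p in s, (ENNReal.ofReal (T.dist p.1 p.2) - ENNReal.ofReal R)
          ∂(T.measure.prod T.measure) + ENNReal.ofReal R * (T.measure.prod T.measure) s := by
        rw [lintegral_add_right _ measurable_const, setLIntegral_const]
    _ ≤ _ := by gcongr; exact setLIntegral_le_lintegral _ _

lemma tail_le_setLIntegral (T : SemimetricTriple.{u}) (R : ℝ) :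
    T.tail R ≤ ∫⁻ p in {p : T.carrier × T.carrier | R < T.dist p.1 p.2},
      ENNReal.ofReal (T.dist p.1 p.2) ∂(T.measure.prod T.measure) := by
  have hm : NullMeasurableSet {p : T.carrier × T.carrier | R < T.dist p.1 p.2}
      (T.measure.prod T.measure) :=
    nullMeasurableSet_lt aemeasurable_const T.measurableSemimetric.aemeasurable
  rw [← lintegral_indicator₀ hm]
  refine lintegral_mono fun p => ?_
  by_cases hp : R < T.dist p.1 p.2
  · rw [Set.indicator_of_mem (by exact hp)]; exact tsub_le_self
  · rw [tsub_eq_zero_of_le (ENNReal.ofReal_le_ofReal (not_lt.1 hp))]; exact zero_le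

end SemimetricTriple

lemma uniformlyIntegrableFamily_of_tail {I : Type v} {T : I → SemimetricTriple.{u}}
    (h : ∀ ε : ℝ≥0∞, 0 < ε → ∃ R : ℝ, 0 ≤ R ∧ ∀ i, (T i).tail R ≤ ε) :
    UniformlyIntegrableFamily T := by
  refine ENNReal.tendsto_nhds_zero.2 fun ε hε => ?_
  obtain ⟨R, hR, hT⟩ := h (ε / 2) (ENNReal.half_pos hε.ne')
  filter_upwards [eventually_ge_atTop (2 * R)] with R' hR'
  refine iSup_le fun i => ((T i).setLIntegral_le_two_mul_tail hR hR').trans ?_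
  calc 2 * (T i).tail R ≤ 2 * (ε / 2) := by gcongr; exact hT i
    _ = ε := ENNReal.mul_div_cancel (by norm_num) (by norm_num)

lemma UniformlyIntegrableFamily.exists_tail_le {I : Type v} {T : I → SemimetricTriple.{u}}
    (h : UniformlyIntegrableFamily T) {ε : ℝ≥0∞} (hε : 0 < ε) :
    ∃ R : ℝ, 0 ≤ R ∧ ∀ i, (T i).tail R ≤ ε := by
  obtain ⟨R, hR, h0⟩ := ((h.eventually_le_const hε).and (eventually_ge_atTop 0)).exists
  exact ⟨R, h0, fun i => ((T i).tail_le_setLIntegral R).trans ((le_iSup (fun i =>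
    ∫⁻ p in {p : (T i).carrier × (T i).carrier | R < (T i).dist p.1 p.2},
      ENNReal.ofReal ((T i).dist p.1 p.2) ∂((T i).measure.prod (T i).measure)) i).trans hR)⟩

/-! ### Covers and entropy. -/

lemma HasEpsCover.mono {X : Type u} [MeasurableSpace X] {μ : Measure X} {ρ : X → X → ℝ} {ε : ℝ}
    {k l : ℕ} (h : HasEpsCover μ ρ ε k) (hkl : k ≤ l) : HasEpsCover μ ρ ε l := by
  obtain ⟨X₀, A, h0, hA, hU, hμ, hd⟩ := h
  refine ⟨X₀, fun j => if hj : j.1 < k then A ⟨j, hj⟩ else ∅, h0, fun j => ?_, ?_, hμ, fun j => ?_⟩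
  · beta_reduce
    split_ifs
    · exact hA _
    · exact nullMeasurableSet_empty
  · refine Set.eq_univ_of_forall fun x => ?_
    rcases hU.ge (Set.mem_univ x) with hx | hx
    · exact .inl hx
    · obtain ⟨j, hj⟩ := Set.mem_iUnion.1 hx
      exact .inr (Set.mem_iUnion.2 ⟨⟨j, j.2.trans_le hkl⟩, by simpa using hj⟩)
  · beta_reduce
    split_ifs
    · exact hd _
    · simpa [semimetricDiam] using pos_of_gt hμ

lemma uniformlyBoundedEntropy_of_hasEpsCover {I : Type v} {T : I → SemimetricTriple.{u}}
    (h : ∀ ε : ℝ, 0 < ε → ∃ N : ℕ, ∀ i, HasEpsCover (T i).measure (T i).dist ε N) :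
    UniformlyBoundedEntropy T := by
  intro ε hε
  by_cases h1 : 1 ≤ ε
  · simp only [epsEntropy, h1, if_true]
    exact iSup_le (fun _ => le_rfl) |>.trans_lt EReal.zero_lt_top
  · obtain ⟨N, hN⟩ := h ε hε
    refine lt_of_le_of_lt (b := ENNReal.log (N : ℝ≥0∞)) (iSup_le fun i => ?_) ?_
    · simp only [epsEntropy, h1, if_false]
      refine ENNReal.log_le_log ?_
      have : epsCoverNumber (T i).measure (T i).dist ε ≤ (N : ℕ∞) := iInf₂_le N (hN i)
      exact_mod_cast ENat.toENNReal_le.2 this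
    · rw [lt_top_iff_ne_top, Ne, ENNReal.log_eq_top_iff]
      exact ENNReal.natCast_ne_top N

lemma UniformlyBoundedEntropy.exists_hasEpsCover {I : Type v} {T : I → SemimetricTriple.{u}}
    (h : UniformlyBoundedEntropy T) {ε : ℝ} (hε : 0 < ε) (hε1 : ε < 1) :
    ∃ N : ℕ, ∀ i, HasEpsCover (T i).measure (T i).dist ε N := by
  have h0 := h ε hε
  set s := ⨆ i, epsEntropy (T i).measure (T i).dist ε with hs
  have hs' : s.exp < ⊤ := by
    rw [lt_top_iff_ne_top, Ne, EReal.exp_eq_top_iff]; exact h0.ne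
  obtain ⟨N, hN⟩ := ENNReal.exists_nat_gt hs'.ne
  refine ⟨N, fun i => ?_⟩
  have h1 : ENNReal.log ((epsCoverNumber (T i).measure (T i).dist ε : ℕ∞) : ℝ≥0∞) ≤ s := by
    have := le_iSup (fun i => epsEntropy (T i).measure (T i).dist ε) i
    rwa [← hs, epsEntropy, if_neg (not_le.2 hε1)] at this
  -- The strict inequality makes the cover number finite and yields an actual cover with at most `N`
  -- pieces.
  have h2 : ((epsCoverNumber (T i).measure (T i).dist ε : ℕ∞) : ℝ≥0∞) < ((N : ℕ∞) : ℝ≥0∞) := by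
    refine lt_of_le_of_lt ?_ (by simpa using hN)
    rw [← ENNReal.exp_log ((epsCoverNumber (T i).measure (T i).dist ε : ℕ∞) : ℝ≥0∞)]
    exact EReal.exp_monotone h1
  have h3 := ENat.toENNReal_lt.1 h2
  simp only [epsCoverNumber, iInf_lt_iff] at h3
  obtain ⟨k, hk, hkN⟩ := h3
  exact hk.mono (by exact_mod_cast hkN.le)

/-! ### Measurability and covers in admissible triples. -/

namespace SemimetricTriple

/-- Joint measurability gives measurable sections only at almost every point. A subset of a
separable set is separable, so the dense sequence can be chosen among the points with measurable
sections. -/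
lemma Admissible.exists_seq {T : SemimetricTriple.{u}} (h : T.Admissible) :
    ∃ (d : ℕ → T.carrier) (G : Set T.carrier), MeasurableSet G ∧ T.measure Gᶜ = 0 ∧
      (∀ x ∈ G, ∀ ε : ℝ, 0 < ε → ∃ n, T.dist x (d n) < ε) ∧
      ∀ n, AEMeasurable (T.dist (d n)) T.measure := by
  obtain ⟨X₀, hX₀, D, hDc, hDX, hD⟩ := h
  let _ := T.toPseudoMetricSpace
  have hsec : ∀ᵐ x ∂T.measure, AEMeasurable (T.dist x) T.measure := by
    filter_upwards [T.measurableSemimetric.aemeasurable.aestronglyMeasurable.prodMk_left]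
      with x hx using hx.aemeasurable
  set G₀ : Set T.carrier := {x | AEMeasurable (T.dist x) T.measure} ∩ X₀ with hG₀
  have hG₀c : T.measure G₀ᶜ = 0 := by
    rw [hG₀, Set.compl_inter]
    exact measure_union_null hsec hX₀
  have hsep : TopologicalSpace.IsSeparable X₀ :=
    ⟨D, hDc, fun x hx => Metric.mem_closure_iff.2 fun ε hε => hD x hx ε hε⟩
  obtain ⟨t, htG, htc, ht⟩ :=
    (hsep.mono Set.inter_subset_right : TopologicalSpace.IsSeparable G₀).exists_countable_dense_subset
  have hne : G₀.Nonempty := by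
    rw [Set.nonempty_iff_ne_empty]
    intro h0
    rw [h0, Set.compl_empty, measure_univ] at hG₀c
    exact one_ne_zero hG₀c
  have htne : t.Nonempty := closure_nonempty_iff.1 (hne.mono ht)
  obtain ⟨d, rfl⟩ := htc.exists_eq_range htne
  obtain ⟨N, hN, hNm, hN0⟩ := exists_measurable_superset_of_null hG₀c
  refine ⟨d, Nᶜ, hNm.compl, by simpa using hN0, fun x hx ε hε => ?_,
    fun n => (htG (Set.mem_range_self n)).1⟩
  have hxG : x ∈ G₀ := by_contra fun hx' => hx (hN hx')
  obtain ⟨_, ⟨n, rfl⟩, hn⟩ := Metric.mem_closure_iff.1 (ht hxG) ε hε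
  exact ⟨n, hn⟩

/-- On `G` the section at an arbitrary `x` equals `inf_n (ρ(x, d n) + ρ(d n, y))`, a countable
infimum of measurable functions. Hence every section is measurable, not just almost every one. -/
lemma Admissible.aemeasurable_dist {T : SemimetricTriple.{u}} (h : T.Admissible) (x : T.carrier) :
    AEMeasurable (fun y => T.dist x y) T.measure := by
  obtain ⟨d, G, -, hG0, hd, hm⟩ := h.exists_seq
  have hs := T.measurableSemimetric.semimetric
  have h1 : AEMeasurable (fun y => ⨅ n, ENNReal.ofReal (T.dist x (d n) + T.dist (d n) y))
      T.measure := AEMeasurable.iInf fun n => ((hm n).const_add _).ennreal_ofReal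
  refine h1.ennreal_toReal.congr ?_
  filter_upwards [(show ∀ᵐ y ∂T.measure, y ∈ G from hG0)] with y hy
  rw [← ENNReal.toReal_ofReal (hs.nonneg x y)]
  congr 1
  refine le_antisymm (ENNReal.le_of_forall_pos_le_add fun ε hε _ => ?_)
    (le_iInf fun n => ENNReal.ofReal_le_ofReal (hs.triangle _ _ _))
  obtain ⟨n, hn⟩ := hd y hy (ε / 2) (by positivity)
  refine (iInf_le _ n).trans ?_
  rw [← ENNReal.ofReal_coe_nnreal, ← ENNReal.ofReal_add (hs.nonneg _ _) (by positivity)]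
  refine ENNReal.ofReal_le_ofReal ?_
  have := hs.triangle x y (d n)
  rw [hs.symm (d n) y]
  linarith

lemma Admissible.nullMeasurableSet_ball {T : SemimetricTriple.{u}} (h : T.Admissible)
    (x : T.carrier) (r : ℝ) : NullMeasurableSet {y | T.dist x y < r} T.measure :=
  nullMeasurableSet_lt (h.aemeasurable_dist x) aemeasurable_const

/-- A distance-preserving map of an admissible triple is almost everywhere measurable. -/
lemma Admissible.aemeasurable_of_isometry {T : SemimetricTriple.{u}} (h : T.Admissible)
    {Y : Type*} [PseudoMetricSpace Y] [MeasurableSpace Y] [BorelSpace Y] {φ : T.carrier → Y}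
    (hφ : ∀ x y, Dist.dist (φ x) (φ y) = T.dist x y) : AEMeasurable φ T.measure := by
  classical
  obtain ⟨d, G, hGm, hG0, hd, hm⟩ := h.exists_seq
  have hs := T.measurableSemimetric.semimetric
  have hae : ∀ᵐ y ∂T.measure, ∀ n, T.dist (d n) y = (hm n).mk _ y :=
    ae_all_iff.2 fun n => (hm n).ae_eq_mk
  obtain ⟨N, hN, hNm, hN0⟩ := exists_measurable_superset_of_null hae
  -- On `H` all distances to the points `d n` agree with Borel functions, so balls around these
  -- points have Borel traces on `H`.
  set H := G ∩ Nᶜ with hH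
  have hHm : MeasurableSet H := hGm.inter hNm.compl
  have hHd : ∀ y ∈ H, ∀ n, T.dist (d n) y = (hm n).mk _ y := fun y hy => by
    by_contra hc
    exact hy.2 (hN hc)
  have hH0 : ∀ᵐ y ∂T.measure, y ∈ H := by
    filter_upwards [(show ∀ᵐ y ∂T.measure, y ∈ G from hG0),
      (show ∀ᵐ y ∂T.measure, y ∈ Nᶜ by rw [ae_iff]; simpa using hN0)] with y h1 h2
    exact ⟨h1, h2⟩
  refine ⟨fun x => if x ∈ H then φ x else φ (d 0), ?_, ?_⟩
  · refine measurable_of_isOpen fun U hU => ?_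
    -- The image need not be second countable, but near the points of `φ '' H` the open set `U` is
    -- exhausted by balls of rational radius around the points `φ (d n)`.
    have key : H ∩ φ ⁻¹' U = ⋃ (n : ℕ) (q : ℚ) (_ : Metric.ball (φ (d n)) q ⊆ U),
        H ∩ {y | (hm n).mk _ y < q} := by
      ext y
      simp only [Set.mem_inter_iff, Set.mem_preimage, Set.mem_iUnion, Set.mem_ofPred_eq, exists_prop]
      constructor
      · rintro ⟨hy, hyU⟩
        obtain ⟨ε, hε, hb⟩ := Metric.isOpen_iff.1 hU _ hyU
        obtain ⟨n, hn⟩ := hd y hy.1 (ε / 2) (by positivity)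
        obtain ⟨q, hq1, hq2⟩ := exists_rat_btwn hn
        refine ⟨n, q, fun z hz => hb ?_, hy, ?_⟩
        · have h1 : Dist.dist z (φ (d n)) < q := hz
          have h2 := dist_triangle z (φ (d n)) (φ y)
          rw [hφ (d n) y, hs.symm] at h2
          exact Metric.mem_ball.2 (by linarith)
        · rw [← hHd y hy n, hs.symm]; exact hq1
      · rintro ⟨n, q, hb, hy, hlt⟩
        refine ⟨hy, hb ?_⟩
        rw [Metric.mem_ball, hφ, hs.symm, hHd y hy n]
        exact hlt
    have hm1 : MeasurableSet (H ∩ φ ⁻¹' U) := by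
      rw [key]
      exact .iUnion fun n => .iUnion fun q => .iUnion fun _ =>
        hHm.inter (measurableSet_lt (hm n).measurable_mk measurable_const)
    have : (fun x => if x ∈ H then φ x else φ (d 0)) ⁻¹' U =
        (H ∩ φ ⁻¹' U) ∪ (Hᶜ ∩ {_x | φ (d 0) ∈ U}) := by
      ext x
      by_cases hx : x ∈ H <;> simp [hx]
    rw [this]
    exact hm1.union (hHm.compl.inter (MeasurableSet.const _))
  · filter_upwards [hH0] with x hx
    simp [hx]

/-- The image of an admissible triple is concentrated on the closure of a sequence. -/
lemma Admissible.exists_map_compl_closure_eq_zero {T : SemimetricTriple.{u}} (h : T.Admissible)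
    {Y : Type*} [PseudoMetricSpace Y] [MeasurableSpace Y] [BorelSpace Y] {φ : T.carrier → Y}
    (hφ : ∀ x y, Dist.dist (φ x) (φ y) = T.dist x y) :
    ∃ d : ℕ → Y, T.measure.map φ (closure (Set.range d))ᶜ = 0 := by
  obtain ⟨d, G, hGm, hG0, hd, hm⟩ := h.exists_seq
  refine ⟨φ ∘ d, ?_⟩
  rw [Measure.map_apply_of_aemeasurable (h.aemeasurable_of_isometry hφ)
    isClosed_closure.measurableSet.compl]
  refine measure_mono_null (t := Gᶜ) (fun x hx hxG => hx ?_) hG0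
  refine Metric.mem_closure_iff.2 fun ε hε => ?_
  obtain ⟨n, hn⟩ := hd x hxG ε hε
  exact ⟨_, ⟨n, rfl⟩, by rwa [Function.comp_apply, hφ]⟩

/-- The complements of the first `k` balls of radius `ε / 3` around a dense sequence decrease to a
null set; continuity from above makes one of them small. -/
lemma Admissible.exists_hasEpsCover {T : SemimetricTriple.{u}} (h : T.Admissible) {ε : ℝ}
    (hε : 0 < ε) : ∃ k, HasEpsCover T.measure T.dist ε k := by
  obtain ⟨d, G, -, hG0, hd, -⟩ := h.exists_seq
  have hs := T.measurableSemimetric.semimetric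
  set s : ℕ → Set T.carrier := fun k => (⋃ j : Fin k, {y | T.dist (d j) y < ε / 3})ᶜ with hsdef
  have hsm : ∀ k, NullMeasurableSet (s k) T.measure := fun k =>
    (NullMeasurableSet.iUnion fun j => h.nullMeasurableSet_ball _ _).compl
  have hanti : Antitone s := fun k l hkl x hx hx' => hx <| by
    obtain ⟨j, hj⟩ := Set.mem_iUnion.1 hx'
    exact Set.mem_iUnion.2 ⟨⟨j, j.2.trans_le hkl⟩, hj⟩
  have hlim := tendsto_measure_iInter_atTop hsm hanti ⟨0, measure_ne_top _ _⟩
  have h0 : T.measure (⋂ k, s k) = 0 := by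
    refine measure_mono_null (t := Gᶜ) (fun x hx hxG => ?_) hG0
    obtain ⟨n, hn⟩ := hd x hxG (ε / 3) (by positivity)
    exact Set.mem_iInter.1 hx (n + 1) (Set.mem_iUnion.2 ⟨⟨n, n.lt_succ_self⟩, by
      rw [Set.mem_ofPred_eq, hs.symm]; exact hn⟩)
  rw [h0] at hlim
  obtain ⟨k, hk⟩ := (hlim.eventually_lt_const (ENNReal.ofReal_pos.2 hε)).exists
  refine ⟨k, s k, _, hsm k, fun j => h.nullMeasurableSet_ball (d j) (ε / 3),
    Set.compl_union_self _, hk, fun j => ?_⟩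
  refine lt_of_le_of_lt (b := ENNReal.ofReal (2 * (ε / 3))) (iSup₂_le fun x hx =>
    iSup₂_le fun y hy => ENNReal.ofReal_le_ofReal ?_)
    ((ENNReal.ofReal_lt_ofReal_iff hε).2 (by linarith))
  have h1 : T.dist (d j) x < ε / 3 := hx
  have h2 : T.dist (d j) y < ε / 3 := hy
  have := hs.triangle x (d j) y
  rw [hs.symm x (d j)] at this
  linarith

end SemimetricTriple

/-- The distance is almost everywhere measurable for a measure on the square of a semimetric space
whose second marginal is concentrated on a separable set. -/
lemma aemeasurable_edist_of_marginal {Y : Type*} [PseudoMetricSpace Y] [MeasurableSpace Y]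
    [BorelSpace Y] {m : Measure (Y × Y)} {d : ℕ → Y}
    (h : m.map Prod.snd (closure (Set.range d))ᶜ = 0) :
    AEMeasurable (fun p : Y × Y => edist p.1 p.2) m := by
  -- `Y` may be non-separable, so `edist` need not be measurable for the product sigma-algebra. This
  -- infimum is measurable and agrees with it wherever the second coordinate lies in the closure of
  -- the sequence.
  have h1 : Measurable (fun p : Y × Y => ⨅ n, (edist p.1 (d n) + edist (d n) p.2)) := by
    refine Measurable.iInf fun n => Measurable.add ?_ ?_
    · exact (continuous_id.edist continuous_const).measurable.comp measurable_fst
    · exact (continuous_const.edist continuous_id).measurable.comp measurable_snd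
  refine ⟨_, h1, ?_⟩
  rw [Measure.map_apply measurable_snd isClosed_closure.measurableSet.compl] at h
  filter_upwards [show ∀ᵐ p ∂m, p.2 ∈ closure (Set.range d) from h] with p hp
  refine le_antisymm (le_iInf fun n => edist_triangle _ _ _)
    (ENNReal.le_of_forall_pos_le_add fun ε hε _ => ?_)
  obtain ⟨_, ⟨n, rfl⟩, hn⟩ := EMetric.mem_closure_iff.1 hp (ε / 2)
    (ENNReal.half_pos (by exact_mod_cast hε.ne'))
  refine (iInf_le _ n).trans ?_
  calc edist p.1 (d n) + edist (d n) p.2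
      ≤ (edist p.1 p.2 + edist p.2 (d n)) + edist (d n) p.2 := by
        gcongr; exact edist_triangle _ _ _
    _ = edist p.1 p.2 + (edist p.2 (d n) + edist p.2 (d n)) := by
        rw [edist_comm (d n), add_assoc]
    _ ≤ edist p.1 p.2 + (ε / 2 + ε / 2) := by gcongr
    _ = edist p.1 p.2 + ε := by rw [ENNReal.add_halves]

/-! ### Stability of tails and covers under `distM`. -/

lemma exists_coupling_of_distM_lt {T S : SemimetricTriple.{u}} {c : ℝ≥0∞} (h : distM T S < c) :
    ∃ (X : Type u) (_ : MeasurableSpace X) (μ : Measure X) (_ : IsProbabilityMeasure μ)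
      (ψ₁ : X → T.carrier) (ψ₂ : X → S.carrier) (D : X → X → ℝ),
      MeasurePreserving ψ₁ μ T.measure ∧ MeasurePreserving ψ₂ μ S.measure ∧
      IsMeasurableSemimetric μ D ∧
      (∀ᵐ p ∂(μ.prod μ), |T.dist (ψ₁ p.1) (ψ₁ p.2) - S.dist (ψ₂ p.1) (ψ₂ p.2)| ≤ D p.1 p.2) ∧
      ∫⁻ p, ENNReal.ofReal (D p.1 p.2) ∂(μ.prod μ) < c := by
  obtain ⟨_, ⟨X, mX, _, μ, hμ, ψ₁, ψ₂, h₁, h₂, rfl⟩, hc⟩ := sInf_lt_iff.1 h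
  obtain ⟨_, ⟨D, hD, hle, rfl⟩, hc⟩ := sInf_lt_iff.1 hc
  exact ⟨X, mX, μ, hμ, ψ₁, ψ₂, D, h₁, h₂, hD, hle, hc⟩

lemma tsub_le_tsub_add_of_le_add {a b d R : ℝ≥0∞} (h : a ≤ b + d) : a - R ≤ (b - R) + d := by
  rw [tsub_le_iff_right]
  calc a ≤ b + d := h
    _ ≤ ((b - R) + R) + d := by gcongr; exact le_tsub_add
    _ = (b - R) + d + R := by rw [add_right_comm]

lemma SemimetricTriple.tail_eq_of_measurePreserving (T : SemimetricTriple.{u}) {X : Type*}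
    [MeasurableSpace X] {μ : Measure X} [SFinite μ] {ψ : X → T.carrier}
    (hψ : MeasurePreserving ψ μ T.measure) (R : ℝ) :
    T.tail R = ∫⁻ p, (ENNReal.ofReal (T.dist (ψ p.1) (ψ p.2)) - ENNReal.ofReal R) ∂(μ.prod μ) := by
  have hp := hψ.prod hψ
  rw [tail, ← hp.map_eq]
  refine lintegral_map' ?_ hp.measurable.aemeasurable
  rw [hp.map_eq]
  exact T.aemeasurable_ofReal_dist.sub aemeasurable_const

lemma SemimetricTriple.tail_le_of_distM_lt {T S : SemimetricTriple.{u}} {c : ℝ≥0∞}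
    (h : distM T S < c) (R : ℝ) : T.tail R ≤ S.tail R + c := by
  obtain ⟨X, _, μ, _, ψ₁, ψ₂, D, h₁, h₂, hD, hle, hc⟩ := exists_coupling_of_distM_lt h
  rw [T.tail_eq_of_measurePreserving h₁, S.tail_eq_of_measurePreserving h₂]
  refine le_trans ?_ (add_le_add_right hc.le _)
  rw [← lintegral_add_right' _ hD.aemeasurable.ennreal_ofReal]
  refine lintegral_mono_ae ?_
  filter_upwards [hle] with p hp
  refine tsub_le_tsub_add_of_le_add ?_
  rw [← ENNReal.ofReal_add (S.measurableSemimetric.semimetric.nonneg _ _)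
    (hD.semimetric.nonneg _ _)]
  exact ENNReal.ofReal_le_ofReal (by linarith [le_abs_self (T.dist (ψ₁ p.1) (ψ₁ p.2) -
    S.dist (ψ₂ p.1) (ψ₂ p.2))])

lemma le_semimetricDiam {X : Type u} {ρ : X → X → ℝ} {A : Set X} {x y : X} (hx : x ∈ A)
    (hy : y ∈ A) : ENNReal.ofReal (ρ x y) ≤ semimetricDiam ρ A :=
  (le_iSup₂_of_le (f := fun y (_ : y ∈ A) => ENNReal.ofReal (ρ x y)) y hy le_rfl).trans
    (le_iSup₂_of_le (f := fun x (_ : x ∈ A) => ⨆ y ∈ A, ENNReal.ofReal (ρ x y)) x hx le_rfl)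

lemma lt_of_semimetricDiam_lt {X : Type u} {ρ : X → X → ℝ} {A : Set X} {ε : ℝ} (hε : 0 < ε)
    (h : semimetricDiam ρ A < ENNReal.ofReal ε) {x y : X} (hx : x ∈ A) (hy : y ∈ A) :
    ρ x y < ε :=
  (ENNReal.ofReal_lt_ofReal_iff hε).1 ((le_semimetricDiam hx hy).trans_lt h)

lemma semimetricDiam_lt {X : Type u} {ρ : X → X → ℝ} {A : Set X} {ε r : ℝ} (hε : 0 < ε)
    (hr : r < ε) (h : ∀ x ∈ A, ∀ y ∈ A, ρ x y ≤ r) : semimetricDiam ρ A < ENNReal.ofReal ε :=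
  lt_of_le_of_lt (iSup₂_le fun x hx => iSup₂_le fun y hy => ENNReal.ofReal_le_ofReal (h x hx y hy))
    ((ENNReal.ofReal_lt_ofReal_iff hε).2 hr)

lemma measure_gt_le_of_lintegral_le {X : Type*} [MeasurableSpace X] {μ : Measure X}
    {f : X → ℝ≥0∞} (hf : AEMeasurable f μ) {δ : ℝ} (hδ : 0 < δ)
    (h : ∫⁻ x, f x ∂μ ≤ ENNReal.ofReal (δ ^ 2)) :
    μ {x | ENNReal.ofReal δ ≤ f x} ≤ ENNReal.ofReal δ := by
  refine (meas_ge_le_lintegral_div hf (ENNReal.ofReal_pos.2 hδ).ne' ENNReal.ofReal_ne_top).trans ?_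
  rw [ENNReal.div_le_iff (ENNReal.ofReal_pos.2 hδ).ne' ENNReal.ofReal_ne_top,
    ← ENNReal.ofReal_mul hδ.le, ← sq]
  exact h

/-- The dominating semimetric `D` has a section `D x₀` of small integral, so off a small set `E` all
points are `D`-close to `x₀` and thus to each other. There the two semimetrics almost agree, and
each piece of the cover of `S` is carried into a small ball of `T`. -/
lemma HasEpsCover.of_distM_lt {T S : SemimetricTriple.{u}} (hT : T.Admissible) {ε : ℝ} (hε : 0 < ε)
    {k : ℕ} (hS : HasEpsCover S.measure S.dist (ε / 4) k)
    (h : distM T S < ENNReal.ofReal ((ε / 16) ^ 2)) : HasEpsCover T.measure T.dist ε k := by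
  obtain ⟨X, _, μ, _, ψ₁, ψ₂, D, h₁, h₂, hD, hle, hc⟩ := exists_coupling_of_distM_lt h
  obtain ⟨B₀, B, hB₀, hB, hU, hμ, hd⟩ := hS
  have hs := T.measurableSemimetric.semimetric
  -- Some section has integral at most the mean; the null set of non-measurable sections can be
  -- avoided.
  obtain ⟨x₀, hx₀, hx₀m⟩ : ∃ x₀, ∫⁻ y, ENNReal.ofReal (D x₀ y) ∂μ ≤ ENNReal.ofReal ((ε / 16) ^ 2) ∧
      AEMeasurable (fun y => ENNReal.ofReal (D x₀ y)) μ := by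
    have hsec : ∀ᵐ x ∂μ, AEMeasurable (D x) μ := by
      filter_upwards [hD.aemeasurable.aestronglyMeasurable.prodMk_left] with x hx
        using hx.aemeasurable
    have hm := hD.aemeasurable.ennreal_ofReal
    rw [lintegral_prod _ hm] at hc
    obtain ⟨x, hxn, hx⟩ := exists_notMem_null_le_lintegral hm.lintegral_prod_right' hsec
    exact ⟨x, hx.trans hc.le, (not_not.1 hxn : AEMeasurable (D x) μ).ennreal_ofReal⟩
  have hE := measure_gt_le_of_lintegral_le hx₀m (by positivity : 0 < ε / 16) hx₀
  set E : Set X := {x | ENNReal.ofReal (ε / 16) ≤ ENNReal.ofReal (D x₀ x)} with hEdef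
  -- The bound `3 * ε / 8` is `ε / 4` from the diameter of `B j` plus `ε / 16` for each leg through
  -- `x₀`. Domination holds only almost everywhere, hence the nested quantifiers.
  have hpair : ∀ j, ∀ᵐ x ∂μ, x ∉ E → ψ₂ x ∈ B j → ∀ᵐ y ∂μ, y ∉ E → ψ₂ y ∈ B j →
      T.dist (ψ₁ x) (ψ₁ y) < 3 * ε / 8 := by
    intro j
    filter_upwards [Measure.ae_ae_of_ae_prod hle] with x hx hxE hxB
    filter_upwards [hx] with y hy hyE hyB
    have e1 : D x₀ x < ε / 16 :=
      (ENNReal.ofReal_lt_ofReal_iff (by positivity)).1 (not_le.1 hxE)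
    have e2 : D x₀ y < ε / 16 :=
      (ENNReal.ofReal_lt_ofReal_iff (by positivity)).1 (not_le.1 hyE)
    have e3 := lt_of_semimetricDiam_lt (by positivity) (hd j) hxB hyB
    have e4 := hD.semimetric.triangle x x₀ y
    rw [hD.semimetric.symm x x₀] at e4
    have e5 := (le_abs_self _).trans hy
    linarith
  have hA : ∀ j, ∃ A : Set T.carrier, NullMeasurableSet A T.measure ∧
      semimetricDiam T.dist A < ENNReal.ofReal ε ∧
      ∀ᵐ y ∂μ, y ∉ E → ψ₂ y ∈ B j → ψ₁ y ∈ A := by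
    intro j
    by_cases hj : ∃ x, x ∉ E ∧ ψ₂ x ∈ B j ∧ ∀ᵐ y ∂μ, y ∉ E → ψ₂ y ∈ B j →
      T.dist (ψ₁ x) (ψ₁ y) < 3 * ε / 8
    · obtain ⟨x, -, -, hx⟩ := hj
      refine ⟨_, hT.nullMeasurableSet_ball (ψ₁ x) (3 * ε / 8),
        semimetricDiam_lt (r := 3 * ε / 4) hε (by linarith) fun y hy z hz => ?_, hx⟩
      have e1 : T.dist (ψ₁ x) y < 3 * ε / 8 := hy
      have e2 : T.dist (ψ₁ x) z < 3 * ε / 8 := hz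
      have := hs.triangle y (ψ₁ x) z
      rw [hs.symm y (ψ₁ x)] at this
      linarith
    -- Without an admissible ball center, almost no point off `E` is mapped into `B j`, and the
    -- empty set suffices.
    · refine ⟨∅, nullMeasurableSet_empty, by simpa [semimetricDiam] using hε, ?_⟩
      filter_upwards [hpair j] with x hx hxE hxB
      exact hj ⟨x, hxE, hxB, hx hxE hxB⟩
  choose A hAm hAd hAB using hA
  have hm0 : NullMeasurableSet (⋃ j, A j)ᶜ T.measure := (NullMeasurableSet.iUnion hAm).compl
  refine ⟨(⋃ j, A j)ᶜ, A, hm0, hAm, Set.compl_union_self _, ?_, hAd⟩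
  rw [← h₁.measure_preimage hm0]
  have hsub : ∀ᵐ x ∂μ, x ∈ ψ₁ ⁻¹' (⋃ j, A j)ᶜ → x ∈ E ∪ ψ₂ ⁻¹' B₀ := by
    filter_upwards [ae_all_iff.2 hAB] with x hx hxA
    by_contra hcon
    rw [Set.mem_union, not_or] at hcon
    rcases hU.ge (Set.mem_univ (ψ₂ x)) with hx0 | hxj
    · exact hcon.2 hx0
    · obtain ⟨j, hj⟩ := Set.mem_iUnion.1 hxj
      exact hxA (Set.mem_iUnion.2 ⟨j, hx j hcon.1 hj⟩)
  calc μ (ψ₁ ⁻¹' (⋃ j, A j)ᶜ) ≤ μ (E ∪ ψ₂ ⁻¹' B₀) := measure_mono_ae hsub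
    _ ≤ μ E + μ (ψ₂ ⁻¹' B₀) := measure_union_le _ _
    _ ≤ ENNReal.ofReal (ε / 16) + ENNReal.ofReal (ε / 4) := by
        rw [h₂.measure_preimage hB₀]
        gcongr
    _ < ENNReal.ofReal ε := by
        rw [← ENNReal.ofReal_add (by positivity) (by positivity),
          ENNReal.ofReal_lt_ofReal_iff hε]
        linarith

/-! ### Stability of tails and covers under `distK`. -/

lemma exists_plan_of_distK_lt {T S : SemimetricTriple.{u}} {c : ℝ≥0∞} (h : distK T S < c) :
    ∃ (Y : Type u) (_ : PseudoMetricSpace Y) (_ : MeasurableSpace Y) (_ : BorelSpace Y)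
      (φ₁ : T.carrier → Y) (φ₂ : S.carrier → Y) (γ : Measure (Y × Y)),
      (∀ x y, dist (φ₁ x) (φ₁ y) = T.dist x y) ∧ (∀ x y, dist (φ₂ x) (φ₂ y) = S.dist x y) ∧
      γ.map Prod.fst = T.measure.map φ₁ ∧ γ.map Prod.snd = S.measure.map φ₂ ∧
      ∫⁻ p, edist p.1 p.2 ∂γ < c := by
  obtain ⟨_, ⟨Y, i₁, i₂, i₃, φ₁, φ₂, h₁, h₂, -, -, rfl⟩, hc⟩ := sInf_lt_iff.1 h
  obtain ⟨_, ⟨γ, hγ₁, hγ₂, rfl⟩, hc⟩ := sInf_lt_iff.1 hc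
  exact ⟨Y, i₁, i₂, i₃, φ₁, φ₂, γ, h₁, h₂, hγ₁, hγ₂, hc⟩

namespace SemimetricTriple

variable {T : SemimetricTriple.{u}} {Y : Type*} [PseudoMetricSpace Y] [MeasurableSpace Y]
  [BorelSpace Y] {φ : T.carrier → Y}

lemma Admissible.aemeasurable_edist_map_prod (h : T.Admissible)
    (hφ : ∀ x y, Dist.dist (φ x) (φ y) = T.dist x y) :
    AEMeasurable (fun p : Y × Y => edist p.1 p.2)
      ((T.measure.map φ).prod (T.measure.map φ)) := by
  obtain ⟨d, hd⟩ := h.exists_map_compl_closure_eq_zero hφ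
  refine aemeasurable_edist_of_marginal (d := d) ?_
  rw [Measure.map_snd_prod, Measure.smul_apply, hd, smul_zero]

lemma Admissible.tail_eq_map (h : T.Admissible)
    (hφ : ∀ x y, Dist.dist (φ x) (φ y) = T.dist x y) (R : ℝ) :
    T.tail R = ∫⁻ p, (edist p.1 p.2 - ENNReal.ofReal R)
      ∂((T.measure.map φ).prod (T.measure.map φ)) := by
  have hm := h.aemeasurable_of_isometry hφ
  have hpres : MeasurePreserving (hm.mk φ) T.measure (T.measure.map φ) :=
    ⟨hm.measurable_mk, (Measure.map_congr hm.ae_eq_mk).symm⟩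
  have hp := hpres.prod hpres
  have hme := (h.aemeasurable_edist_map_prod hφ).sub
    (aemeasurable_const (b := ENNReal.ofReal R))
  have h1 : ∫⁻ p, (edist p.1 p.2 - ENNReal.ofReal R)
      ∂((T.measure.map φ).prod (T.measure.map φ)) =
      ∫⁻ p, (edist (hm.mk φ p.1) (hm.mk φ p.2) - ENNReal.ofReal R)
        ∂(T.measure.prod T.measure) := by
    rw [← hp.map_eq] at hme ⊢
    exact lintegral_map' hme hp.measurable.aemeasurable
  rw [h1, tail]
  refine lintegral_congr_ae ?_
  filter_upwards [Measure.quasiMeasurePreserving_fst.ae hm.ae_eq_mk,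
    Measure.quasiMeasurePreserving_snd.ae hm.ae_eq_mk] with p h1 h2
  rw [← h1, ← h2, edist_dist, hφ]

/-- Two independent samples of the plan `γ` are compared: the distance between the first coordinates
exceeds that between the second ones by at most the two transport lengths. This gives the factor 2.
-/
lemma tail_le_of_distK_lt {T S : SemimetricTriple.{u}} (hT : T.Admissible) (hS : S.Admissible)
    {c : ℝ≥0∞} (h : distK T S < c) (R : ℝ) : T.tail R ≤ S.tail R + 2 * c := by
  obtain ⟨Y, _, _, _, φ₁, φ₂, γ, hφ₁, hφ₂, hγ₁, hγ₂, hc⟩ := exists_plan_of_distK_lt h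
  have hm₁ := hT.aemeasurable_of_isometry hφ₁
  have hm₂ := hS.aemeasurable_of_isometry hφ₂
  have hγ : IsProbabilityMeasure γ := by
    have : IsProbabilityMeasure (γ.map Prod.fst) := by
      rw [hγ₁]; exact Measure.isProbabilityMeasure_map hm₁
    exact Measure.isProbabilityMeasure_of_map (f := Prod.fst)
  obtain ⟨d, hd⟩ := hS.exists_map_compl_closure_eq_zero hφ₂
  have hme : AEMeasurable (fun p : Y × Y => edist p.1 p.2) γ :=
    aemeasurable_edist_of_marginal (d := d) (by rw [hγ₂, hd])
  have hp₁ : MeasurePreserving (Prod.fst : Y × Y → Y) γ (T.measure.map φ₁) :=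
    ⟨measurable_fst, hγ₁⟩
  have hp₂ : MeasurePreserving (Prod.snd : Y × Y → Y) γ (S.measure.map φ₂) :=
    ⟨measurable_snd, hγ₂⟩
  have hpp₁ := hp₁.prod hp₁
  have hpp₂ := hp₂.prod hp₂
  have e₁ : T.tail R = ∫⁻ q, (edist q.1.1 q.2.1 - ENNReal.ofReal R) ∂(γ.prod γ) := by
    have hme := (hT.aemeasurable_edist_map_prod hφ₁).sub
      (aemeasurable_const (b := ENNReal.ofReal R))
    rw [hT.tail_eq_map hφ₁]
    rw [← hpp₁.map_eq] at hme ⊢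
    exact lintegral_map' hme hpp₁.measurable.aemeasurable
  have e₂ : S.tail R = ∫⁻ q, (edist q.1.2 q.2.2 - ENNReal.ofReal R) ∂(γ.prod γ) := by
    have hme := (hS.aemeasurable_edist_map_prod hφ₂).sub
      (aemeasurable_const (b := ENNReal.ofReal R))
    rw [hS.tail_eq_map hφ₂]
    rw [← hpp₂.map_eq] at hme ⊢
    exact lintegral_map' hme hpp₂.measurable.aemeasurable
  have hq₁ : MeasurePreserving (Prod.fst : (Y × Y) × (Y × Y) → Y × Y) (γ.prod γ) γ :=
    measurePreserving_fst
  have hq₂ : MeasurePreserving (Prod.snd : (Y × Y) × (Y × Y) → Y × Y) (γ.prod γ) γ :=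
    measurePreserving_snd
  have i₁ : ∫⁻ q : (Y × Y) × (Y × Y), edist q.1.1 q.1.2 ∂(γ.prod γ) = ∫⁻ p, edist p.1 p.2 ∂γ := by
    conv_rhs => rw [← hq₁.map_eq]
    exact (lintegral_map' (by rwa [hq₁.map_eq]) hq₁.measurable.aemeasurable).symm
  have i₂ : ∫⁻ q : (Y × Y) × (Y × Y), edist q.2.1 q.2.2 ∂(γ.prod γ) = ∫⁻ p, edist p.1 p.2 ∂γ := by
    conv_rhs => rw [← hq₂.map_eq]
    exact (lintegral_map' (by rwa [hq₂.map_eq]) hq₂.measurable.aemeasurable).symm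
  have hmq₁ : AEMeasurable (fun q : (Y × Y) × (Y × Y) => edist q.1.1 q.1.2) (γ.prod γ) :=
    hme.comp_quasiMeasurePreserving hq₁.quasiMeasurePreserving
  have hmq₂ : AEMeasurable (fun q : (Y × Y) × (Y × Y) => edist q.2.1 q.2.2) (γ.prod γ) :=
    hme.comp_quasiMeasurePreserving hq₂.quasiMeasurePreserving
  have hadd : AEMeasurable (fun q : (Y × Y) × (Y × Y) => edist q.1.1 q.1.2 + edist q.2.1 q.2.2)
      (γ.prod γ) := hmq₁.add hmq₂
  calc T.tail R = ∫⁻ q, (edist q.1.1 q.2.1 - ENNReal.ofReal R) ∂(γ.prod γ) := e₁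
    _ ≤ ∫⁻ q, ((edist q.1.2 q.2.2 - ENNReal.ofReal R) + (edist q.1.1 q.1.2 + edist q.2.1 q.2.2))
          ∂(γ.prod γ) := by
        refine lintegral_mono fun q => tsub_le_tsub_add_of_le_add ?_
        calc edist q.1.1 q.2.1 ≤ edist q.1.1 q.1.2 + edist q.1.2 q.2.2 + edist q.2.2 q.2.1 :=
              edist_triangle4 _ _ _ _
          _ = _ := by rw [edist_comm q.2.2]; ring
    _ = S.tail R + 2 * ∫⁻ p, edist p.1 p.2 ∂γ := by
        rw [lintegral_add_right' _ hadd, lintegral_add_right' _ hmq₂, i₁, i₂, e₂, two_mul]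
    _ ≤ S.tail R + 2 * c := by gcongr

end SemimetricTriple

lemma HasEpsCover.of_distK_lt {T S : SemimetricTriple.{u}} (hT : T.Admissible) (hS : S.Admissible)
    {ε : ℝ} (hε : 0 < ε) {k : ℕ} (hcov : HasEpsCover S.measure S.dist (ε / 4) k)
    (h : distK T S < ENNReal.ofReal ((ε / 16) ^ 2)) : HasEpsCover T.measure T.dist ε k := by
  obtain ⟨Y, _, _, _, φ₁, φ₂, γ, hφ₁, hφ₂, hγ₁, hγ₂, hc⟩ := exists_plan_of_distK_lt h
  obtain ⟨B₀, B, hB₀, hB, hU, hμ, hd⟩ := hcov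
  have hm₁ := hT.aemeasurable_of_isometry hφ₁
  have hm₂ := hS.aemeasurable_of_isometry hφ₂
  obtain ⟨d, hdd⟩ := hS.exists_map_compl_closure_eq_zero hφ₂
  have hme : AEMeasurable (fun p : Y × Y => edist p.1 p.2) γ :=
    aemeasurable_edist_of_marginal (d := d) (by rw [hγ₂, hdd])
  have hr : 0 < ε / 16 := by positivity
  have hE := measure_gt_le_of_lintegral_le hme hr hc.le
  -- The images `φ₂ '' B j` need not be measurable, but their thickenings are open. One `ε / 16`
  -- makes room for measurability, the other for the transport length.
  set A : Fin k → Set Y := fun j => Metric.thickening (ε / 16 + ε / 16) (φ₂ '' B j) with hA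
  set C : Set Y := (⋃ j, A j)ᶜ with hC
  set C' : Set Y := (⋃ j, Metric.thickening (ε / 16) (φ₂ '' B j))ᶜ with hC'
  have hCm : MeasurableSet C :=
    (isOpen_iUnion fun j => Metric.isOpen_thickening).measurableSet.compl
  have hCm' : MeasurableSet C' :=
    (isOpen_iUnion fun j => Metric.isOpen_thickening).measurableSet.compl
  refine ⟨φ₁ ⁻¹' C, fun j => φ₁ ⁻¹' A j, hm₁.nullMeasurableSet_preimage hCm,
    fun j => hm₁.nullMeasurableSet_preimage Metric.isOpen_thickening.measurableSet, ?_, ?_,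
    fun j => ?_⟩
  · rw [← Set.preimage_iUnion, ← Set.preimage_union, hC, Set.compl_union_self, Set.preimage_univ]
  · have hsub : (Prod.fst ⁻¹' C : Set (Y × Y)) ⊆
        {p | ENNReal.ofReal (ε / 16) ≤ edist p.1 p.2} ∪ Prod.snd ⁻¹' C' := by
      intro p hp
      by_contra hcon
      rw [Set.mem_union, not_or] at hcon
      obtain ⟨h1, h2⟩ := hcon
      obtain ⟨j, hj⟩ := Set.mem_iUnion.1 (not_not.1 h2)
      obtain ⟨z, hz, hpz⟩ := Metric.mem_thickening_iff.1 hj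
      refine hp (Set.mem_iUnion.2 ⟨j, Metric.mem_thickening_iff.2 ⟨z, hz, ?_⟩⟩)
      have h3 : dist p.1 p.2 < ε / 16 := by
        have h1 : edist p.1 p.2 < ENNReal.ofReal (ε / 16) := not_le.1 fun h => h1 h
        rw [edist_dist] at h1
        exact (ENNReal.ofReal_lt_ofReal_iff hr).1 h1
      linarith [dist_triangle p.1 p.2 z]
    have hC0 : φ₂ ⁻¹' C' ⊆ B₀ := by
      intro x hx
      rcases hU.ge (Set.mem_univ x) with hx0 | hxj
      · exact hx0
      · obtain ⟨j, hj⟩ := Set.mem_iUnion.1 hxj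
        exact absurd (Set.mem_iUnion.2 ⟨j, Metric.self_subset_thickening hr _
          (Set.mem_image_of_mem _ hj)⟩) hx
    calc T.measure (φ₁ ⁻¹' C) = γ (Prod.fst ⁻¹' C) := by
          rw [← Measure.map_apply_of_aemeasurable hm₁ hCm, ← hγ₁,
            Measure.map_apply measurable_fst hCm]
      _ ≤ γ {p | ENNReal.ofReal (ε / 16) ≤ edist p.1 p.2} + γ (Prod.snd ⁻¹' C') :=
          (measure_mono hsub).trans (measure_union_le _ _)
      _ ≤ ENNReal.ofReal (ε / 16) + ENNReal.ofReal (ε / 4) := by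
          refine add_le_add hE ?_
          rw [← Measure.map_apply measurable_snd hCm', hγ₂,
            Measure.map_apply_of_aemeasurable hm₂ hCm']
          exact (measure_mono hC0).trans hμ.le
      _ < ENNReal.ofReal ε := by
          rw [← ENNReal.ofReal_add (by positivity) (by positivity),
            ENNReal.ofReal_lt_ofReal_iff hε]
          linarith
  · refine semimetricDiam_lt (r := ε / 2) hε (by linarith) fun x hx y hy => ?_
    obtain ⟨_, ⟨z, hz, rfl⟩, hxz⟩ := Metric.mem_thickening_iff.1 hx
    obtain ⟨_, ⟨w, hw, rfl⟩, hyw⟩ := Metric.mem_thickening_iff.1 hy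
    have h1 := lt_of_semimetricDiam_lt (by positivity) (hd j) hz hw
    rw [← hφ₂] at h1
    rw [← hφ₁]
    have h2 := dist_triangle4 (φ₁ x) (φ₂ z) (φ₂ w) (φ₁ y)
    rw [dist_comm (φ₂ w)] at h2
    linarith

/-! ### Necessity of the two conditions. -/

/-- A distance that controls the tails and the covers up to an error makes the two conditions
necessary for precompactness. -/
lemma IsPrecompactFor.conditions {I : Type v} {T : I → SemimetricTriple.{u}}
    (hadm : ∀ i, (T i).Admissible) (hsum : ∀ i, (T i).Summable)
    {δ : SemimetricTriple.{u} → SemimetricTriple.{u} → ℝ≥0∞}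
    (htail : ∀ i j c, δ (T i) (T j) < c → ∀ R, (T i).tail R ≤ (T j).tail R + 2 * c)
    (hcov : ∀ i j ε, 0 < ε → δ (T i) (T j) < ENNReal.ofReal ((ε / 16) ^ 2) → ∀ k,
      HasEpsCover (T j).measure (T j).dist (ε / 4) k → HasEpsCover (T i).measure (T i).dist ε k)
    (h : IsPrecompactFor δ (Set.range T)) :
    UniformlyIntegrableFamily T ∧ UniformlyBoundedEntropy T := by
  constructor
  · refine uniformlyIntegrableFamily_of_tail fun ε hε => ?_
    -- The bound `4η` is `2η` for the tail of the net point plus `2η` for passing to its neighbour.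
    obtain ⟨η, hη, hηε⟩ : ∃ η : ℝ, 0 < η ∧ 4 * ENNReal.ofReal η ≤ ε := by
      obtain ⟨c, hc, hcε⟩ := ENNReal.lt_iff_exists_nnreal_btwn.1 hε
      refine ⟨c / 4, by have : (0 : NNReal) < c := by exact_mod_cast hc
                        positivity, ?_⟩
      rw [show (4 : ℝ≥0∞) = ENNReal.ofReal 4 by simp, ← ENNReal.ofReal_mul (by norm_num),
        mul_div_cancel₀ _ (by norm_num), ENNReal.ofReal_coe_nnreal]
      exact hcε.le
    obtain ⟨F, hF, hFT, hnet⟩ := h η hη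
    have hev : ∀ᶠ R in atTop, ∀ s ∈ F, s.tail R ≤ 2 * ENNReal.ofReal η := by
      refine (eventually_all_finite hF).2 fun s hs => ?_
      obtain ⟨j, rfl⟩ := hFT hs
      exact (hsum j).eventually_tail_le (by simpa using hη)
    obtain ⟨R, hR, hR0⟩ := (hev.and (eventually_ge_atTop 0)).exists
    refine ⟨R, hR0, fun i => ?_⟩
    obtain ⟨s, hs, hlt⟩ := hnet (T i) ⟨i, rfl⟩
    obtain ⟨j, rfl⟩ := hFT hs
    refine (htail i j _ hlt R).trans (le_trans ?_ hηε)
    calc (T j).tail R + 2 * ENNReal.ofReal η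
        ≤ 2 * ENNReal.ofReal η + 2 * ENNReal.ofReal η := by gcongr; exact hR _ hs
      _ = 4 * ENNReal.ofReal η := by ring
  · refine uniformlyBoundedEntropy_of_hasEpsCover fun ε hε => ?_
    obtain ⟨F, hF, hFT, hnet⟩ := h ((ε / 16) ^ 2) (by positivity)
    have hk : ∀ s : SemimetricTriple.{u}, ∃ k, s ∈ F → HasEpsCover s.measure s.dist (ε / 4) k := by
      intro s
      by_cases hs : s ∈ F
      · obtain ⟨j, rfl⟩ := hFT hs
        obtain ⟨k, hk⟩ := (hadm j).exists_hasEpsCover (by positivity : 0 < ε / 4)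
        exact ⟨k, fun _ => hk⟩
      · exact ⟨0, fun h => absurd h hs⟩
    choose k hk using hk
    obtain ⟨N, hN⟩ := (hF.image k).bddAbove
    refine ⟨N, fun i => ?_⟩
    obtain ⟨s, hs, hlt⟩ := hnet (T i) ⟨i, rfl⟩
    obtain ⟨j, rfl⟩ := hFT hs
    exact (hcov i j ε hε hlt _ (hk _ hs)).mono (hN (Set.mem_image_of_mem _ hs))

/-! ### Couplings of labelled probability spaces. -/

/-- The law of total probability for the pieces of a finite measurable labelling. -/
lemma sum_measure_mul_cond {Z L : Type*} [MeasurableSpace Z] [Fintype L] [MeasurableSpace L]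
    [MeasurableSingletonClass L] (κ : Measure Z) [IsProbabilityMeasure κ] {c : Z → L}
    (hc : Measurable c) (E : Set Z) :
    ∑ j, κ (c ⁻¹' {j}) * ProbabilityTheory.cond κ (c ⁻¹' {j}) E = κ E := by
  have h1 : ∀ j, κ (c ⁻¹' {j}) * ProbabilityTheory.cond κ (c ⁻¹' {j}) E
      = κ.restrict (c ⁻¹' {j}) E := by
    intro j
    have hj : MeasurableSet (c ⁻¹' {j}) := hc (measurableSet_singleton j)
    rw [ProbabilityTheory.cond, Measure.smul_apply, smul_eq_mul, ← mul_assoc]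
    by_cases h0 : κ (c ⁻¹' {j}) = 0
    · rw [Measure.restrict_eq_zero.2 h0]; simp
    · rw [ENNReal.mul_inv_cancel h0 (measure_ne_top _ _), one_mul]
  simp_rw [h1]
  have h2 := Measure.restrict_iUnion (μ := κ) (s := fun j => c ⁻¹' {j})
    (fun i j hij => Disjoint.preimage _ (by simpa using hij))
    (fun j => hc (measurableSet_singleton j))
  rw [← Set.preimage_iUnion, Set.iUnion_of_singleton, Set.preimage_univ, Measure.restrict_univ,
    Measure.sum_fintype] at h2
  conv_rhs => rw [h2]
  rw [Measure.finsetSum_apply]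

/-- Two probability spaces that are partitioned into equally many pieces have a coupling in which
corresponding pieces are matched up to the differences of their measures. -/
lemma exists_coupling_of_labels {X X' L : Type*} [MeasurableSpace X] [MeasurableSpace X']
    [Fintype L] [MeasurableSpace L] [MeasurableSingletonClass L]
    (μ : Measure X) [IsProbabilityMeasure μ] (ν : Measure X') [IsProbabilityMeasure ν]
    {a : X → L} {b : X' → L} (ha : Measurable a) (hb : Measurable b) :
    ∃ γ : Measure (X × X'), γ.map Prod.fst = μ ∧ γ.map Prod.snd = ν ∧
      γ {p | a p.1 ≠ b p.2} ≤ ∑ j, (μ (a ⁻¹' {j}) - ν (b ⁻¹' {j})) := by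
  classical
  set p : L → ℝ≥0∞ := fun j => μ (a ⁻¹' {j}) with hp
  set q : L → ℝ≥0∞ := fun j => ν (b ⁻¹' {j}) with hq
  -- The common mass `m j` is coupled within the matching pieces; the leftovers `μr` and `νr` have
  -- the same mass `s` and are coupled independently.
  set m : L → ℝ≥0∞ := fun j => min (p j) (q j) with hm
  set α : L → Measure X := fun j => ProbabilityTheory.cond μ (a ⁻¹' {j}) with hα
  set β : L → Measure X' := fun j => ProbabilityTheory.cond ν (b ⁻¹' {j}) with hβ
  have hα1 : ∀ j t, t ≤ p j → t * α j Set.univ = t := by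
    intro j t ht
    by_cases h0 : p j = 0
    · rw [h0] at ht; rw [nonpos_iff_eq_zero.1 ht, zero_mul]
    · have := ProbabilityTheory.cond_isProbabilityMeasure (μ := μ) h0
      rw [measure_univ, mul_one]
  have hβ1 : ∀ j t, t ≤ q j → t * β j Set.univ = t := by
    intro j t ht
    by_cases h0 : q j = 0
    · rw [h0] at ht; rw [nonpos_iff_eq_zero.1 ht, zero_mul]
    · have := ProbabilityTheory.cond_isProbabilityMeasure (μ := ν) h0
      rw [measure_univ, mul_one]
  have hsp : ∑ j, p j = 1 := by
    have := sum_measure_mul_cond μ ha Set.univ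
    rw [measure_univ] at this
    rw [← this]
    exact Finset.sum_congr rfl fun j _ => (hα1 j _ le_rfl).symm
  have hsq : ∑ j, q j = 1 := by
    have := sum_measure_mul_cond ν hb Set.univ
    rw [measure_univ] at this
    rw [← this]
    exact Finset.sum_congr rfl fun j _ => (hβ1 j _ le_rfl).symm
  have hmp : ∀ j, m j ≤ p j := fun j => min_le_left _ _
  have hmq : ∀ j, m j ≤ q j := fun j => min_le_right _ _
  set s := ∑ j, (p j - m j) with hs
  have hmfin : ∑ j, m j ≠ ∞ :=
    ((Finset.sum_le_sum fun j _ => hmp j).trans_lt (by rw [hsp]; exact ENNReal.one_lt_top)).ne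
  have hs1 : s + ∑ j, m j = 1 := by
    rw [hs, ← Finset.sum_add_distrib, ← hsp]
    exact Finset.sum_congr rfl fun j _ => tsub_add_cancel_of_le (hmp j)
  have hs2 : ∑ j, (q j - m j) = s := by
    refine (ENNReal.add_left_inj hmfin).1 ?_
    rw [hs1, ← Finset.sum_add_distrib, ← hsq]
    exact Finset.sum_congr rfl fun j _ => tsub_add_cancel_of_le (hmq j)
  have hsfin : s ≠ ∞ := ne_top_of_le_ne_top ENNReal.one_ne_top (hs1 ▸ le_self_add)
  set μr : Measure X := Measure.sum fun j => (p j - m j) • α j with hμr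
  set νr : Measure X' := Measure.sum fun j => (q j - m j) • β j with hνr
  have hμra : ∀ E, μr E = ∑ j, (p j - m j) * α j E := fun E => by
    rw [hμr, Measure.sum_fintype, Measure.finsetSum_apply]; rfl
  have hνra : ∀ E, νr E = ∑ j, (q j - m j) * β j E := fun E => by
    rw [hνr, Measure.sum_fintype, Measure.finsetSum_apply]; rfl
  have hμr1 : μr Set.univ = s := by
    rw [hμra]; exact Finset.sum_congr rfl fun j _ => hα1 j _ tsub_le_self
  have hνr1 : νr Set.univ = s := by
    rw [hνra, ← hs2]; exact Finset.sum_congr rfl fun j _ => hβ1 j _ tsub_le_self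
  -- This covers `s = 0` too: then the factor `s⁻¹ = ∞` multiplies a zero measure.
  have hss : ∀ t, t ≤ s → s⁻¹ * (t * s) = t := by
    intro t ht
    by_cases h0 : s = 0
    · rw [h0] at ht ⊢; rw [nonpos_iff_eq_zero.1 ht]; simp
    · rw [mul_comm t, ← mul_assoc, ENNReal.inv_mul_cancel h0 hsfin, one_mul]
  set γ : Measure (X × X') :=
    (Measure.sum fun j => m j • (α j).prod (β j)) + s⁻¹ • μr.prod νr with hγ
  have hγa : ∀ E, γ E = ∑ j, m j * (α j).prod (β j) E + s⁻¹ * μr.prod νr E := fun E => by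
    rw [hγ, Measure.add_apply, Measure.sum_fintype, Measure.finsetSum_apply]; rfl
  refine ⟨γ, ?_, ?_, ?_⟩
  · ext E hE
    rw [Measure.map_apply measurable_fst hE, ← Set.prod_univ, hγa]
    simp_rw [Measure.prod_prod]
    rw [hνr1, hss _ (hμr1 ▸ measure_mono (Set.subset_univ E)), hμra, ← Finset.sum_add_distrib,
      ← sum_measure_mul_cond μ ha E]
    refine Finset.sum_congr rfl fun j _ => ?_
    rw [mul_comm (α j E), ← mul_assoc, hβ1 j _ (hmq j), ← add_mul, add_tsub_cancel_of_le (hmp j)]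
  · ext E hE
    rw [Measure.map_apply measurable_snd hE, ← Set.univ_prod, hγa]
    simp_rw [Measure.prod_prod]
    rw [hμr1, mul_comm s, hss _ (hνr1 ▸ measure_mono (Set.subset_univ E)), hνra,
      ← Finset.sum_add_distrib, ← sum_measure_mul_cond ν hb E]
    refine Finset.sum_congr rfl fun j _ => ?_
    rw [← mul_assoc, hα1 j _ (hmp j), ← add_mul, add_tsub_cancel_of_le (hmq j)]
  · have h0 : ∀ j, (α j).prod (β j) {p | a p.1 ≠ b p.2} = 0 := by
      intro j
      have hA : α j (a ⁻¹' {j})ᶜ = 0 := by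
        rw [hα, ProbabilityTheory.cond_apply (ha (measurableSet_singleton j))]; simp
      have hB : β j (b ⁻¹' {j})ᶜ = 0 := by
        rw [hβ, ProbabilityTheory.cond_apply (hb (measurableSet_singleton j))]; simp
      refine measure_mono_null (t := (a ⁻¹' {j})ᶜ ×ˢ Set.univ ∪ Set.univ ×ˢ (b ⁻¹' {j})ᶜ)
        (fun x hx => ?_) (measure_union_null ?_ ?_)
      · by_contra hcon
        simp only [Set.mem_union, Set.mem_prod, Set.mem_compl_iff, Set.mem_preimage,
          Set.mem_singleton_iff, Set.mem_univ, and_true, true_and, not_or, not_not] at hcon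
        exact hx (hcon.1.trans hcon.2.symm)
      · rw [Measure.prod_prod, hA, zero_mul]
      · rw [Measure.prod_prod, hB, mul_zero]
    have h1 : ∑ j, (p j - q j) = s :=
      Finset.sum_congr rfl fun j _ => (tsub_min (a := p j) (b := q j)).symm
    rw [h1, hγa]
    simp_rw [h0, mul_zero, Finset.sum_const_zero, zero_add]
    calc s⁻¹ * μr.prod νr {p | a p.1 ≠ b p.2} ≤ s⁻¹ * μr.prod νr (Set.univ ×ˢ Set.univ) := by
          gcongr; rw [Set.univ_prod_univ]; exact Set.subset_univ _
      _ = s := by rw [Measure.prod_prod, hμr1, hνr1, hss s le_rfl]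

/-! ### Cross distances and the bounds they give. -/

/-- A function on the product of two triples that extends their semimetrics to a semimetric on the
disjoint union. -/
structure IsCrossDist (T S : SemimetricTriple.{u}) (f : T.carrier → S.carrier → ℝ) : Prop where
  nonneg : ∀ x y, 0 ≤ f x y
  left_le : ∀ x x' y, T.dist x x' ≤ f x y + f x' y
  right_le : ∀ x y y', S.dist y y' ≤ f x y + f x y'
  le_left : ∀ x x' y, f x y ≤ T.dist x x' + f x' y
  le_right : ∀ x y y', f x y ≤ f x y' + S.dist y' y

namespace IsCrossDist

variable {T S : SemimetricTriple.{u}} {f : T.carrier → S.carrier → ℝ}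

lemma abs_sub_le (h : IsCrossDist T S f) (x x' : T.carrier) (y y' : S.carrier) :
    |T.dist x x' - S.dist y y'| ≤ f x y + f x' y' := by
  have h1 := h.left_le x x' y
  have h2 := h.le_right x' y y'
  have h3 := h.right_le x y y'
  have h4 := h.le_left x x' y'
  rw [S.measurableSemimetric.semimetric.symm y' y] at h2
  rw [_root_.abs_sub_le_iff]
  constructor <;> linarith

/-- The pseudometric on the disjoint union defined by a cross distance. -/
abbrev pseudoMetricSpace (h : IsCrossDist T S f) :
    PseudoMetricSpace (T.carrier ⊕ S.carrier) where
  dist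
    | .inl x, .inl x' => T.dist x x'
    | .inl x, .inr y => f x y
    | .inr y, .inl x => f x y
    | .inr y, .inr y' => S.dist y y'
  dist_self := by
    rintro (x | y)
    · exact T.measurableSemimetric.semimetric.self x
    · exact S.measurableSemimetric.semimetric.self y
  dist_comm := by
    rintro (x | y) (x' | y')
    · exact T.measurableSemimetric.semimetric.symm x x'
    · rfl
    · rfl
    · exact S.measurableSemimetric.semimetric.symm y y'
  dist_triangle := by
    rintro (x | x) (y | y) (z | z)
    · exact T.measurableSemimetric.semimetric.triangle x y z
    · exact h.le_left x y z
    · exact h.left_le x z y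
    · exact h.le_right x z y
    · exact (h.le_left z y x).trans_eq (by
        rw [add_comm, T.measurableSemimetric.semimetric.symm z y])
    · exact h.right_le y x z
    · exact (h.le_right z x y).trans_eq (by
        rw [add_comm, S.measurableSemimetric.semimetric.symm y x])
    · exact S.measurableSemimetric.semimetric.triangle x y z

/-- The coupling, pushed to the disjoint union with the glued pseudometric, is a transport plan
whose cost is at most the integral of `f`. -/
lemma distK_le (h : IsCrossDist T S f) (hT : T.Admissible) (hS : S.Admissible)
    {γ : Measure (T.carrier × S.carrier)} (h₁ : γ.map Prod.fst = T.measure)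
    (h₂ : γ.map Prod.snd = S.measure) :
    distK T S ≤ ∫⁻ p, ENNReal.ofReal (f p.1 p.2) ∂γ := by
  let _ := h.pseudoMetricSpace
  let _ : MeasurableSpace (T.carrier ⊕ S.carrier) := borel _
  have : BorelSpace (T.carrier ⊕ S.carrier) := ⟨rfl⟩
  set φ₁ : T.carrier → T.carrier ⊕ S.carrier := Sum.inl with hφ₁
  set φ₂ : S.carrier → T.carrier ⊕ S.carrier := Sum.inr with hφ₂
  have i₁ : ∀ x y, dist (φ₁ x) (φ₁ y) = T.dist x y := fun _ _ => rfl
  have i₂ : ∀ x y, dist (φ₂ x) (φ₂ y) = S.dist x y := fun _ _ => rfl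
  have m₁ := hT.aemeasurable_of_isometry i₁
  have m₂ := hS.aemeasurable_of_isometry i₂
  have m₁' : AEMeasurable (fun p : T.carrier × S.carrier => φ₁ p.1) γ :=
    (h₁.symm ▸ m₁ : AEMeasurable φ₁ (γ.map Prod.fst)).comp_measurable measurable_fst
  have m₂' : AEMeasurable (fun p : T.carrier × S.carrier => φ₂ p.2) γ :=
    (h₂.symm ▸ m₂ : AEMeasurable φ₂ (γ.map Prod.snd)).comp_measurable measurable_snd
  have m : AEMeasurable (fun p : T.carrier × S.carrier => (φ₁ p.1, φ₂ p.2)) γ := m₁'.prodMk m₂'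
  refine (sInf_le ⟨_, _, _, inferInstance, φ₁, φ₂, i₁, i₂, m₁, m₂, rfl⟩ : distK T S ≤ _).trans ?_
  refine (sInf_le ⟨γ.map (fun p => (φ₁ p.1, φ₂ p.2)), ?_, ?_, rfl⟩ :
    kantorovichDist _ _ ≤ _).trans ?_
  · rw [AEMeasurable.map_map_of_aemeasurable measurable_fst.aemeasurable m, ← h₁,
      AEMeasurable.map_map_of_aemeasurable (h₁.symm ▸ m₁) measurable_fst.aemeasurable]
    rfl
  · rw [AEMeasurable.map_map_of_aemeasurable measurable_snd.aemeasurable m, ← h₂,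
      AEMeasurable.map_map_of_aemeasurable (h₂.symm ▸ m₂) measurable_snd.aemeasurable]
    rfl
  · refine (lintegral_map_le _ _).trans (lintegral_mono fun p => ?_)
    rw [edist_dist]
    exact le_rfl

/-- The coupling space is the product itself. By the four-point inequality `abs_sub_le`, the
difference of the semimetrics is dominated by `f(p) + f(q)`, which is a semimetric once it is set to
zero on the diagonal. -/
lemma distM_le (h : IsCrossDist T S f)
    {γ : Measure (T.carrier × S.carrier)} (h₁ : γ.map Prod.fst = T.measure)
    (h₂ : γ.map Prod.snd = S.measure) (hf : AEMeasurable (fun p => f p.1 p.2) γ) :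
    distM T S ≤ 2 * ∫⁻ p, ENNReal.ofReal (f p.1 p.2) ∂γ := by
  have hγ : IsProbabilityMeasure γ := by
    have : IsProbabilityMeasure (γ.map Prod.fst) := by rw [h₁]; infer_instance
    exact Measure.isProbabilityMeasure_of_map (f := Prod.fst)
  set g : T.carrier × S.carrier → ℝ := fun p => f p.1 p.2 with hg
  have hg0 : ∀ p, 0 ≤ g p := fun p => h.nonneg _ _
  have hgm₁ : AEMeasurable (fun z : (T.carrier × S.carrier) × (T.carrier × S.carrier) => g z.1)
      (γ.prod γ) := hf.comp_quasiMeasurePreserving Measure.quasiMeasurePreserving_fst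
  have hgm₂ : AEMeasurable (fun z : (T.carrier × S.carrier) × (T.carrier × S.carrier) => g z.2)
      (γ.prod γ) := hf.comp_quasiMeasurePreserving Measure.quasiMeasurePreserving_snd
  set D : T.carrier × S.carrier → T.carrier × S.carrier → ℝ := fun p q =>
    (Set.diagonal (T.carrier × S.carrier))ᶜ.indicator (fun z => g z.1 + g z.2) (p, q) with hD
  have hDself : ∀ p, D p p = 0 := fun p => by simp [hD]
  have hDne : ∀ {p q}, p ≠ q → D p q = g p + g q := fun {p q} hpq => by simp [hD, hpq]
  have hDle : ∀ p q, D p q ≤ g p + g q := fun p q => by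
    rcases eq_or_ne p q with rfl | hpq
    · rw [hDself]; linarith [hg0 p]
    · exact (hDne hpq).le
  have hD0 : ∀ p q, 0 ≤ D p q := fun p q => by
    rcases eq_or_ne p q with rfl | hpq
    · rw [hDself]
    · rw [hDne hpq]; linarith [hg0 p, hg0 q]
  have hDs : IsMeasurableSemimetric γ D := by
    refine ⟨⟨hD0, hDself, fun p q => ?_, fun p q r => ?_⟩, ?_⟩
    · rcases eq_or_ne p q with rfl | hpq
      · rfl
      · rw [hDne hpq, hDne hpq.symm, add_comm]
    · rcases eq_or_ne p q with rfl | hpq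
      · rw [hDself, zero_add]
      rcases eq_or_ne q r with rfl | hqr
      · rw [hDself, add_zero]
      rw [hDne hpq, hDne hqr]
      linarith [hDle p r, hg0 q]
    · exact (hgm₁.add hgm₂).indicator measurableSet_diagonal.compl
  refine (sInf_le ⟨_, inferInstance, inferInstance, γ, hγ, Prod.fst, Prod.snd,
    ⟨measurable_fst, h₁⟩, ⟨measurable_snd, h₂⟩, rfl⟩ : distM T S ≤ _).trans ?_
  refine (sInf_le ⟨D, hDs, .of_forall fun z => ?_, rfl⟩ :
    mNorm γ (fun x y => T.dist x.1 y.1 - S.dist x.2 y.2) ≤ _).trans ?_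
  · rcases eq_or_ne z.1 z.2 with hz | hz
    · rw [hz]
      beta_reduce
      rw [T.measurableSemimetric.semimetric.self, S.measurableSemimetric.semimetric.self, hDself]
      simp
    · rw [hDne hz]
      exact h.abs_sub_le _ _ _ _
  · have e₁ : ∫⁻ z : (T.carrier × S.carrier) × (T.carrier × S.carrier), ENNReal.ofReal (g z.1)
        ∂(γ.prod γ) = ∫⁻ p, ENNReal.ofReal (g p) ∂γ := by
      rw [lintegral_prod _ hgm₁.ennreal_ofReal]; simp
    have e₂ : ∫⁻ z : (T.carrier × S.carrier) × (T.carrier × S.carrier), ENNReal.ofReal (g z.2)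
        ∂(γ.prod γ) = ∫⁻ p, ENNReal.ofReal (g p) ∂γ := by
      rw [lintegral_prod _ hgm₂.ennreal_ofReal]; simp
    calc ∫⁻ z, ENNReal.ofReal (D z.1 z.2) ∂(γ.prod γ)
        ≤ ∫⁻ z, (ENNReal.ofReal (g z.1) + ENNReal.ofReal (g z.2)) ∂(γ.prod γ) :=
          lintegral_mono fun z => by
            rw [← ENNReal.ofReal_add (hg0 _) (hg0 _)]
            exact ENNReal.ofReal_le_ofReal (hDle _ _)
      _ = 2 * ∫⁻ p, ENNReal.ofReal (g p) ∂γ := by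
          rw [lintegral_add_right' _ hgm₂.ennreal_ofReal, e₁, e₂, two_mul]

end IsCrossDist

/-! ### Existence of uniform discretizations. -/

/-- A partition of a triple into `n` pieces of small diameter and a remainder that contributes
little, with centers at bounded distances from each other. -/
structure Discretization (T : SemimetricTriple.{u}) (n : ℕ) (K δ : ℝ) where
  label : T.carrier → Fin (n + 1)
  center : Fin (n + 1) → T.carrier
  measurable_label : Measurable label
  dist_center_le : ∀ x, label x ≠ 0 → T.dist x (center (label x)) ≤ δ
  dist_centers_le : ∀ j l, T.dist (center j) (center l) ≤ K
  lintegral_le : ∫⁻ x in label ⁻¹' {0}, ENNReal.ofReal (T.dist x (center 0)) ∂T.measure ≤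
    ENNReal.ofReal δ

namespace SemimetricTriple

/-- On `B ×ˢ B'`, of measure at least `τ²`, the semimetric is at least `T.dist z w - 2 * δ`; a large
value of the latter would contradict the bound on the integral. -/
lemma dist_le_of_mem_of_le_measure (T : SemimetricTriple.{u}) {A A' B B' : Set T.carrier}
    (hBA : B ⊆ A) (hBA' : B' ⊆ A') (hB : MeasurableSet B) (hB' : MeasurableSet B')
    {τ δ C : ℝ} (hτ : 0 < τ) (hC : 0 ≤ C)
    (hμB : ENNReal.ofReal τ ≤ T.measure B) (hμB' : ENNReal.ofReal τ ≤ T.measure B')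
    (hA : ∀ x ∈ A, ∀ y ∈ A, T.dist x y ≤ δ) (hA' : ∀ x ∈ A', ∀ y ∈ A', T.dist x y ≤ δ)
    (hint : ∫⁻ p, ENNReal.ofReal (T.dist p.1 p.2) ∂(T.measure.prod T.measure) ≤ ENNReal.ofReal C)
    {z w : T.carrier} (hz : z ∈ A) (hw : w ∈ A') : T.dist z w ≤ 2 * δ + C / τ ^ 2 := by
  have hs := T.measurableSemimetric.semimetric
  have h1 : ENNReal.ofReal (T.dist z w - 2 * δ) * (ENNReal.ofReal τ * ENNReal.ofReal τ) ≤
      ENNReal.ofReal C := by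
    calc ENNReal.ofReal (T.dist z w - 2 * δ) * (ENNReal.ofReal τ * ENNReal.ofReal τ)
        ≤ ENNReal.ofReal (T.dist z w - 2 * δ) * (T.measure.prod T.measure) (B ×ˢ B') := by
          rw [Measure.prod_prod]; gcongr
      _ = ∫⁻ _p in B ×ˢ B', ENNReal.ofReal (T.dist z w - 2 * δ) ∂(T.measure.prod T.measure) :=
          (setLIntegral_const _ _).symm
      _ ≤ ∫⁻ p in B ×ˢ B', ENNReal.ofReal (T.dist p.1 p.2) ∂(T.measure.prod T.measure) := by
          refine setLIntegral_mono' (hB.prod hB') fun p hp => ENNReal.ofReal_le_ofReal ?_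
          have e1 := hA z hz p.1 (hBA hp.1)
          have e2 := hA' p.2 (hBA' hp.2) w hw
          have e3 := hs.triangle z p.1 w
          have e4 := hs.triangle p.1 p.2 w
          linarith
      _ ≤ _ := (setLIntegral_le_lintegral _ _).trans hint
  by_cases h0 : T.dist z w - 2 * δ ≤ 0
  · have : 0 ≤ C / τ ^ 2 := by positivity
    linarith
  · rw [← ENNReal.ofReal_mul hτ.le, ← ENNReal.ofReal_mul (not_le.1 h0).le,
      ENNReal.ofReal_le_ofReal_iff hC, ← sq, ← le_div_iff₀ (by positivity)] at h1
    linarith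

/-- Pieces of measure below `τ` join the remainder, labelled `0`, so that all centers lie in heavy
pieces and their mutual distances are controlled by the integral of the semimetric. Averaging
supplies the center for the remainder. -/
lemma nonempty_discretization (T : SemimetricTriple.{u}) {R δ ε : ℝ}
    (hδ : 0 < δ) (hR : 0 ≤ R) (hε : 0 < ε) (hεδ : ε ≤ δ) (hε4 : ε ≤ 1 / 4)
    (hεR : 2 * ε * R ≤ δ / 8) (htail : T.tail R ≤ ENNReal.ofReal (δ / 8)) {n : ℕ}
    (hcov : HasEpsCover T.measure T.dist ε n) :
    Nonempty (Discretization T n (2 * δ + (R + δ / 8) / (ε / (n + 1)) ^ 2) δ) := by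
  classical
  obtain ⟨X₀, A, -, hA, hU, hμ, hd⟩ := hcov
  have hs := T.measurableSemimetric.semimetric
  choose B hBA hBm hBae using fun j => (hA j).exists_measurable_subset_ae_eq
  set τ : ℝ := ε / (n + 1) with hτdef
  have hτ : 0 < τ := by positivity
  set J : Set (Fin n) := {j | ENNReal.ofReal τ ≤ T.measure (A j)} with hJ
  set P : Fin n → T.carrier → Fin (n + 1) := fun j x => if j ∈ J ∧ x ∈ B j then j.succ else 0
    with hP
  -- Overlaps are resolved by the largest index of a heavy piece containing the point; `0` is left
  -- for points in none.
  set a : T.carrier → Fin (n + 1) := fun x => Finset.univ.sup fun j => P j x with ha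
  have ham : Measurable a := by
    have hPm : ∀ j, Measurable (P j) := fun j =>
      Measurable.ite ((MeasurableSet.const _).inter (hBm j)) measurable_const measurable_const
    have h2 : Measurable fun x (j : Fin n) => P j x := measurable_pi_lambda _ hPm
    exact (measurable_of_countable fun v : Fin n → Fin (n + 1) => Finset.univ.sup v).comp h2
  have ha0 : ∀ x, a x = 0 → ∀ j ∈ J, x ∉ B j := by
    intro x hx j hj hxB
    have h1 : P j x ≤ a x := Finset.le_sup (f := fun j => P j x) (Finset.mem_univ j)
    rw [hx, hP] at h1
    simp only [hj, hxB, and_self, if_true] at h1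
    exact absurd h1 (by simp)
  have ha1 : ∀ x, a x ≠ 0 → ∃ j ∈ J, x ∈ B j ∧ a x = j.succ := by
    intro x hx
    have hne : (Finset.univ : Finset (Fin n)).Nonempty := by
      rw [Finset.nonempty_iff_ne_empty]
      intro h0
      exact hx (by simp only [ha, h0, Finset.sup_empty]; rfl)
    obtain ⟨j, -, hj⟩ := Finset.exists_mem_eq_sup _ hne fun j => P j x
    have hj : a x = P j x := hj
    by_cases hc : j ∈ J ∧ x ∈ B j
    · exact ⟨j, hc.1, hc.2, by rw [hj, hP]; simp [hc]⟩
    · exact absurd (by rw [hj, hP]; simp only [hc, if_false]) hx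
  set E : Set T.carrier := a ⁻¹' {0} with hE
  have hEm : MeasurableSet E := ham (measurableSet_singleton 0)
  -- `X₀` costs `ε`, the light pieces at most `n * τ ≤ ε`, and the differences `A j \ B j` are null.
  have hμE : T.measure E ≤ ENNReal.ofReal (2 * ε) := by
    have hsub : E ⊆ X₀ ∪ ⋃ j, (if j ∈ J then A j \ B j else A j) := by
      intro x hx
      rcases hU.ge (Set.mem_univ x) with hx0 | hxj
      · exact .inl hx0
      · obtain ⟨j, hj⟩ := Set.mem_iUnion.1 hxj
        refine .inr (Set.mem_iUnion.2 ⟨j, ?_⟩)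
        split_ifs with hjJ
        · exact ⟨hj, ha0 x hx j hjJ⟩
        · exact hj
    have hpiece : ∀ j, T.measure (if j ∈ J then A j \ B j else A j) ≤ ENNReal.ofReal τ := by
      intro j
      split_ifs with hjJ
      · rw [ae_le_set.1 (hBae j).symm.le]; exact zero_le
      · exact (not_le.1 hjJ).le
    calc T.measure E ≤ T.measure X₀ + ∑ j, T.measure (if j ∈ J then A j \ B j else A j) :=
          (measure_mono hsub).trans ((measure_union_le _ _).trans
            (add_le_add_right (measure_iUnion_fintype_le _ _) _))
      _ ≤ ENNReal.ofReal ε + ∑ _j : Fin n, ENNReal.ofReal τ :=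
          add_le_add hμ.le (Finset.sum_le_sum fun j _ => hpiece j)
      _ = ENNReal.ofReal (ε + n * τ) := by
          rw [ENNReal.ofReal_add hε.le (by positivity), ENNReal.ofReal_mul (by positivity)]
          simp
      _ ≤ ENNReal.ofReal (2 * ε) := by
          refine ENNReal.ofReal_le_ofReal ?_
          have : n * τ ≤ ε := by
            rw [hτdef, mul_div_assoc', div_le_iff₀ (by positivity)]
            nlinarith
          linarith
  have hμEc : 1 / 2 ≤ T.measure Eᶜ := by
    rw [prob_compl_eq_one_sub hEm]
    have h1 : T.measure E ≤ 1 / 2 := hμE.trans (by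
      rw [show (1 / 2 : ℝ≥0∞) = ENNReal.ofReal (1 / 2) by
        rw [ENNReal.ofReal_div_of_pos (by norm_num)]; simp]
      exact ENNReal.ofReal_le_ofReal (by linarith))
    calc (1 / 2 : ℝ≥0∞) = 1 - 1 / 2 := by simp
      _ ≤ 1 - T.measure E := tsub_le_tsub_left h1 _
  -- The integral over `E ×ˢ Eᶜ` is at most `δ / 8 + 2 * ε * R ≤ δ / 2`. As `Eᶜ` has measure at
  -- least `1 / 2`, some `y` in it has inner integral at most `δ`.
  obtain ⟨y, hyE, hy⟩ : ∃ y ∈ Eᶜ, ∫⁻ x in E, ENNReal.ofReal (T.dist x y) ∂T.measure ≤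
      ENNReal.ofReal δ := by
    have hm : AEMeasurable (fun p : T.carrier × T.carrier => ENNReal.ofReal (T.dist p.1 p.2))
        ((T.measure.restrict E).prod (T.measure.restrict Eᶜ)) := by
      rw [Measure.prod_restrict]; exact T.aemeasurable_ofReal_dist.restrict
    have hμ0 : T.measure Eᶜ ≠ 0 := fun h0 => by rw [h0] at hμEc; simp at hμEc
    obtain ⟨y, hyE, hy⟩ := exists_le_setLAverage hμ0 (measure_ne_top _ _)
      (f := fun y => ∫⁻ x in E, ENNReal.ofReal (T.dist x y) ∂T.measure)
      hm.prod_swap.lintegral_prod_right'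
    refine ⟨y, hyE, hy.trans ?_⟩
    rw [setLAverage_eq, ENNReal.div_le_iff hμ0 (measure_ne_top _ _)]
    have h2 := lintegral_prod_symm _ hm
    rw [Measure.prod_restrict] at h2
    rw [← h2]
    refine (T.lintegral_le_tail_add _ R).trans ?_
    calc T.tail R + ENNReal.ofReal R * (T.measure.prod T.measure) (E ×ˢ Eᶜ)
        ≤ ENNReal.ofReal (δ / 8) + ENNReal.ofReal R * ENNReal.ofReal (2 * ε) := by
          rw [Measure.prod_prod]
          gcongr
          exact (mul_le_mul' hμE prob_le_one).trans_eq (mul_one _)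
      _ ≤ ENNReal.ofReal (δ * (1 / 2)) := by
          rw [← ENNReal.ofReal_mul hR, ← ENNReal.ofReal_add (by positivity) (by positivity)]
          exact ENNReal.ofReal_le_ofReal (by linarith)
      _ ≤ ENNReal.ofReal δ * T.measure Eᶜ := by
          rw [ENNReal.ofReal_mul hδ.le]
          gcongr
          rwa [ENNReal.ofReal_div_of_pos (by norm_num), ENNReal.ofReal_one,
            show ENNReal.ofReal 2 = 2 by simp]
  have hne : ∀ j ∈ J, (A j).Nonempty := fun j hj => by
    rw [Set.nonempty_iff_ne_empty]
    intro h0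
    have hj : ENNReal.ofReal τ ≤ T.measure (A j) := hj
    rw [h0, measure_empty] at hj
    exact (ENNReal.ofReal_pos.2 hτ).ne' (nonpos_iff_eq_zero.1 hj)
  have hdiam : ∀ j, ∀ x ∈ A j, ∀ y ∈ A j, T.dist x y ≤ δ := fun j x hx y hy =>
    (lt_of_semimetricDiam_lt hε (hd j) hx hy).le.trans hεδ
  -- Indices of light pieces are never used as labels; their center defaults to `y`, which lies in a
  -- heavy piece and keeps the bound on center distances.
  set c : Fin (n + 1) → T.carrier :=
    Fin.cons y fun j => if hj : j ∈ J then (hne j hj).some else y with hc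
  have hcJ : ∀ j (hj : j ∈ J), c j.succ ∈ A j := fun j hj => by
    simp only [hc, Fin.cons_succ, hj, dif_pos]
    exact (hne j hj).some_mem
  obtain ⟨jy, hjy, hyB, -⟩ := ha1 y hyE
  have hcA : ∀ l, ∃ j ∈ J, c l ∈ A j := by
    intro l
    refine Fin.cases ?_ (fun j => ?_) l
    · exact ⟨jy, hjy, hBA jy hyB⟩
    · by_cases hj : j ∈ J
      · exact ⟨j, hj, hcJ j hj⟩
      · refine ⟨jy, hjy, ?_⟩
        simp only [hc, Fin.cons_succ, hj, dif_neg, not_false_eq_true]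
        exact hBA jy hyB
  have hint : ∫⁻ p, ENNReal.ofReal (T.dist p.1 p.2) ∂(T.measure.prod T.measure) ≤
      ENNReal.ofReal (R + δ / 8) := by
    have := T.lintegral_le_tail_add Set.univ R
    rw [Measure.restrict_univ, measure_univ, mul_one] at this
    refine this.trans ?_
    rw [ENNReal.ofReal_add hR (by positivity), add_comm]
    gcongr
  refine ⟨⟨a, c, ham, fun x hx => ?_, fun j l => ?_, hy⟩⟩
  · obtain ⟨j, hj, hxB, hax⟩ := ha1 x hx
    rw [hax]
    exact hdiam j x (hBA j hxB) _ (hcJ j hj)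
  · obtain ⟨i, hi, hcj⟩ := hcA j
    obtain ⟨i', hi', hcl⟩ := hcA l
    exact T.dist_le_of_mem_of_le_measure (hBA i) (hBA i') (hBm i) (hBm i') hτ (by positivity)
      (by rw [measure_congr (hBae i)]; exact hi) (by rw [measure_congr (hBae i')]; exact hi')
      (hdiam i) (hdiam i') hint hcj hcl

end SemimetricTriple

lemma exists_nonempty_discretization {I : Type v} {T : I → SemimetricTriple.{u}}
    (hui : UniformlyIntegrableFamily T) (hent : UniformlyBoundedEntropy T) {δ : ℝ} (hδ : 0 < δ) :
    ∃ (n : ℕ) (K : ℝ), 0 ≤ K ∧ ∀ i, Nonempty (Discretization (T i) n K δ) := by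
  obtain ⟨R, hR, htail⟩ := hui.exists_tail_le (ENNReal.ofReal_pos.2 (by positivity : 0 < δ / 8))
  set ε := min (min δ (1 / 4)) (δ / (16 * (R + 1))) with hεdef
  have hε : 0 < ε := by positivity
  have h1 : ε ≤ δ := (min_le_left _ _).trans (min_le_left _ _)
  have h2 : ε ≤ 1 / 4 := (min_le_left _ _).trans (min_le_right _ _)
  have h3 : ε * (16 * (R + 1)) ≤ δ := (le_div_iff₀ (by positivity)).1 (min_le_right _ _)
  obtain ⟨N, hN⟩ := hent.exists_hasEpsCover hε (by linarith)
  exact ⟨N, _, by positivity, fun i => (T i).nonempty_discretization hδ hR hε h1 h2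
    (by linarith) (htail i) (hN i)⟩

/-! ### Comparison of discretized triples. -/

section

variable {T S : SemimetricTriple.{u}}

/-- Two almost isometric finite families of points define a cross distance. -/
lemma isCrossDist_iInf {ι : Type*} [Finite ι] [Nonempty ι] {c : ι → T.carrier} {c' : ι → S.carrier}
    {δ : ℝ} (hδ : 0 ≤ δ) (h : ∀ j l, |T.dist (c j) (c l) - S.dist (c' j) (c' l)| ≤ 2 * δ) :
    IsCrossDist T S fun x y => ⨅ j, (T.dist x (c j) + δ + S.dist (c' j) y) := by
  have hT := T.measurableSemimetric.semimetric
  have hS := S.measurableSemimetric.semimetric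
  have hle : ∀ x y j, ⨅ j, (T.dist x (c j) + δ + S.dist (c' j) y) ≤
      T.dist x (c j) + δ + S.dist (c' j) y := fun x y j =>
    ciInf_le (Set.finite_range _).bddBelow j
  have hex : ∀ x y, ∃ j, T.dist x (c j) + δ + S.dist (c' j) y =
      ⨅ j, (T.dist x (c j) + δ + S.dist (c' j) y) := fun x y => exists_eq_ciInf_of_finite
  refine ⟨fun x y => ?_, fun x x' y => ?_, fun x y y' => ?_, fun x x' y => ?_, fun x y y' => ?_⟩
  · exact le_ciInf fun j => by linarith [hT.nonneg x (c j), hS.nonneg (c' j) y]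
  -- Two paths cross two bridges of length `δ`; this `2 * δ` absorbs the discrepancy between the
  -- distances of the centers `j` and `l` in the two spaces.
  · obtain ⟨j, hj⟩ := hex x y
    obtain ⟨l, hl⟩ := hex x' y
    have e1 := hT.triangle x (c j) x'
    have e2 := hT.triangle (c j) (c l) x'
    have e3 := hS.triangle (c' j) y (c' l)
    have e4 := (le_abs_self _).trans (h j l)
    rw [hT.symm (c l)] at e2
    rw [hS.symm y] at e3
    rw [← hj, ← hl]
    linarith
  · obtain ⟨j, hj⟩ := hex x y
    obtain ⟨l, hl⟩ := hex x y'
    have e1 := hS.triangle y (c' j) y'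
    have e2 := hS.triangle (c' j) (c' l) y'
    have e3 := hT.triangle (c j) x (c l)
    have e4 := (neg_abs_le _).trans' (neg_le_neg (h j l))
    rw [hS.symm y (c' j)] at e1
    rw [hT.symm (c j) x] at e3
    rw [← hj, ← hl]
    linarith
  · obtain ⟨j, hj⟩ := hex x' y
    rw [← hj]
    linarith [hle x y j, hT.triangle x x' (c j)]
  · obtain ⟨j, hj⟩ := hex x y'
    rw [← hj]
    linarith [hle x y j, hS.triangle (c' j) y' y]

variable {n : ℕ} {K δ : ℝ}

lemma Discretization.dist_center_zero_le (A : Discretization T n K δ) {x : T.carrier}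
    (hx : A.label x ≠ 0) : T.dist x (A.center 0) ≤ K + δ := by
  linarith [T.measurableSemimetric.semimetric.triangle x (A.center (A.label x)) (A.center 0),
    A.dist_center_le x hx, A.dist_centers_le (A.label x) 0]

lemma Discretization.ofReal_dist_center_zero_le (A : Discretization T n K δ)
    (x : T.carrier) : ENNReal.ofReal (T.dist x (A.center 0)) ≤
      ENNReal.ofReal (K + δ) +
        (A.label ⁻¹' {0}).indicator (fun x => ENNReal.ofReal (T.dist x (A.center 0))) x := by
  by_cases hx : A.label x = 0
  · rw [Set.indicator_of_mem (by exact hx)]; exact le_add_self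
  · exact (ENNReal.ofReal_le_ofReal (A.dist_center_zero_le hx)).trans le_self_add

/-- Points with the same nonzero label are joined through their common center at cost `3 * δ`. All
other pairs go through center `0`: each point in a remainder pays its own distance to that center,
and other points pay at most `K + δ`, which occurs only when the labels differ. -/
lemma ofReal_crossDist_le (A : Discretization T n K δ) (B : Discretization S n K δ) (hδ : 0 ≤ δ)
    (hK : 0 ≤ K) (x : T.carrier) (y : S.carrier) :
    ENNReal.ofReal (⨅ j, (T.dist x (A.center j) + δ + S.dist (B.center j) y)) ≤
      (A.label ⁻¹' {0}).indicator (fun x => ENNReal.ofReal (T.dist x (A.center 0))) x +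
      ((B.label ⁻¹' {0}).indicator (fun y => ENNReal.ofReal (S.dist y (B.center 0))) y +
      (ENNReal.ofReal (3 * δ) + {p : T.carrier × S.carrier | A.label p.1 ≠ B.label p.2}.indicator
        (fun _ => ENNReal.ofReal (2 * (K + δ))) (x, y))) := by
  have hT := T.measurableSemimetric.semimetric
  have hS := S.measurableSemimetric.semimetric
  have hle : ∀ j, ⨅ j, (T.dist x (A.center j) + δ + S.dist (B.center j) y) ≤
      T.dist x (A.center j) + δ + S.dist (B.center j) y := fun j =>
    ciInf_le (Set.finite_range _).bddBelow j
  have h0 : ENNReal.ofReal (⨅ j, (T.dist x (A.center j) + δ + S.dist (B.center j) y)) ≤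
      ENNReal.ofReal (T.dist x (A.center 0)) + ENNReal.ofReal δ +
        ENNReal.ofReal (S.dist y (B.center 0)) := by
    rw [← ENNReal.ofReal_add (hT.nonneg _ _) hδ, ← ENNReal.ofReal_add
      (add_nonneg (hT.nonneg _ _) hδ) (hS.nonneg _ _), hS.symm y]
    exact ENNReal.ofReal_le_ofReal (hle 0)
  have h3 : ENNReal.ofReal δ ≤ ENNReal.ofReal (3 * δ) := ENNReal.ofReal_le_ofReal (by linarith)
  by_cases hab : A.label x = B.label y
  · by_cases hx : A.label x = 0
    · have hy : B.label y = 0 := hab ▸ hx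
      rw [Set.indicator_of_mem (show x ∈ A.label ⁻¹' {0} from hx),
        Set.indicator_of_mem (show y ∈ B.label ⁻¹' {0} from hy)]
      refine h0.trans ?_
      rw [add_assoc]
      exact add_le_add le_rfl ((add_comm _ _).trans_le (add_le_add le_rfl (h3.trans le_self_add)))
    · have hy : B.label y ≠ 0 := hab ▸ hx
      refine le_trans (le_trans (ENNReal.ofReal_le_ofReal ?_) le_self_add)
        (le_add_self.trans le_add_self)
      have e1 := A.dist_center_le x hx
      have e2 := B.dist_center_le y hy
      have e3 := hle (A.label x)
      rw [← hab, hS.symm] at e2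
      linarith
  · rw [Set.indicator_of_mem (show (x, y) ∈ {p : T.carrier × S.carrier |
      A.label p.1 ≠ B.label p.2} from hab)]
    refine h0.trans ?_
    have e1 := A.ofReal_dist_center_zero_le x
    have e2 := B.ofReal_dist_center_zero_le y
    refine (add_le_add (add_le_add e1 h3) e2).trans_eq ?_
    rw [two_mul, ENNReal.ofReal_add (by positivity : 0 ≤ K + δ) (by positivity)]
    ring

/-- Triples with close discretizations are close. -/
lemma Discretization.exists_crossDist_le (A : Discretization T n K δ) (B : Discretization S n K δ)
    (hTa : T.Admissible) (hSa : S.Admissible) (hδ : 0 ≤ δ) (hK : 0 ≤ K) {θ : ℝ}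
    (hθ : (n + 1) * θ * (2 * (K + δ)) ≤ δ)
    (hdist : ∀ j l,
      |T.dist (A.center j) (A.center l) - S.dist (B.center j) (B.center l)| ≤ 2 * δ)
    (hmeas : ∀ j, T.measure (A.label ⁻¹' {j}) ≤ S.measure (B.label ⁻¹' {j}) + ENNReal.ofReal θ) :
    distK T S ≤ ENNReal.ofReal (6 * δ) ∧ distM T S ≤ 2 * ENNReal.ofReal (6 * δ) := by
  obtain ⟨γ, h₁, h₂, hγ⟩ := exists_coupling_of_labels T.measure S.measure A.measurable_label
    B.measurable_label
  have hcross := isCrossDist_iInf hδ hdist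
  have hp₁ : MeasurePreserving (Prod.fst : T.carrier × S.carrier → T.carrier) γ T.measure :=
    ⟨measurable_fst, h₁⟩
  have hp₂ : MeasurePreserving (Prod.snd : T.carrier × S.carrier → S.carrier) γ S.measure :=
    ⟨measurable_snd, h₂⟩
  have hprob : IsProbabilityMeasure γ := by
    have : IsProbabilityMeasure (γ.map Prod.fst) := by rw [h₁]; infer_instance
    exact Measure.isProbabilityMeasure_of_map (f := Prod.fst)
  have hmT : ∀ j, AEMeasurable (fun x => T.dist x (A.center j)) T.measure := fun j => by
    simp_rw [T.measurableSemimetric.semimetric.symm _ (A.center j)]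
    exact hTa.aemeasurable_dist _
  have hmS : ∀ j, AEMeasurable (fun y => S.dist y (B.center j)) S.measure := fun j => by
    simp_rw [S.measurableSemimetric.semimetric.symm _ (B.center j)]
    exact hSa.aemeasurable_dist _
  have hm : AEMeasurable (fun p : T.carrier × S.carrier =>
      ⨅ j, (T.dist p.1 (A.center j) + δ + S.dist (B.center j) p.2)) γ :=
    AEMeasurable.iInf fun j => (((hmT j).comp_quasiMeasurePreserving
      hp₁.quasiMeasurePreserving).add_const δ).add ((hSa.aemeasurable_dist
        (B.center j)).comp_quasiMeasurePreserving hp₂.quasiMeasurePreserving)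
  have hA0 : MeasurableSet (A.label ⁻¹' {0}) := A.measurable_label (measurableSet_singleton 0)
  have hB0 : MeasurableSet (B.label ⁻¹' {0}) := B.measurable_label (measurableSet_singleton 0)
  have hN : MeasurableSet {p : T.carrier × S.carrier | A.label p.1 ≠ B.label p.2} :=
    (measurableSet_eq_fun (A.measurable_label.comp measurable_fst)
      (B.measurable_label.comp measurable_snd)).compl
  have key : ∫⁻ p, ENNReal.ofReal (⨅ j, (T.dist p.1 (A.center j) + δ + S.dist (B.center j) p.2)) ∂γ
      ≤ ENNReal.ofReal (6 * δ) := by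
    set f : T.carrier → ℝ≥0∞ := (A.label ⁻¹' {0}).indicator
      (fun x => ENNReal.ofReal (T.dist x (A.center 0))) with hf
    set g : S.carrier → ℝ≥0∞ := (B.label ⁻¹' {0}).indicator
      (fun y => ENNReal.ofReal (S.dist y (B.center 0))) with hg
    have hfm : AEMeasurable f T.measure := (hmT 0).ennreal_ofReal.indicator hA0
    have hgm : AEMeasurable g S.measure := (hmS 0).ennreal_ofReal.indicator hB0
    have hfm' : AEMeasurable (fun p : T.carrier × S.carrier => f p.1) γ :=
      hfm.comp_quasiMeasurePreserving hp₁.quasiMeasurePreserving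
    have hgm' : AEMeasurable (fun p : T.carrier × S.carrier => g p.2) γ :=
      hgm.comp_quasiMeasurePreserving hp₂.quasiMeasurePreserving
    have hfi : ∫⁻ p : T.carrier × S.carrier, f p.1 ∂γ ≤ ENNReal.ofReal δ := by
      rw [← lintegral_map' (by rwa [h₁]) measurable_fst.aemeasurable, h₁, hf, lintegral_indicator hA0]
      exact A.lintegral_le
    have hgi : ∫⁻ p : T.carrier × S.carrier, g p.2 ∂γ ≤ ENNReal.ofReal δ := by
      rw [← lintegral_map' (by rwa [h₂]) measurable_snd.aemeasurable, h₂, hg, lintegral_indicator hB0]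
      exact B.lintegral_le
    have hsum : ∑ j, (T.measure (A.label ⁻¹' {j}) - S.measure (B.label ⁻¹' {j})) ≤
        ENNReal.ofReal ((n + 1) * θ) := by
      calc _ ≤ ∑ _j : Fin (n + 1), ENNReal.ofReal θ :=
            Finset.sum_le_sum fun j _ => tsub_le_iff_left.2 (hmeas j)
        _ = _ := by
            rw [ENNReal.ofReal_mul (by positivity), ENNReal.ofReal_add (by positivity) zero_le_one]
            simp
    set N : Set (T.carrier × S.carrier) := {p | A.label p.1 ≠ B.label p.2} with hNdef
    set C : ℝ≥0∞ := ENNReal.ofReal (2 * (K + δ)) with hC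
    -- The mismatched mass is at most `(n + 1) * θ` and costs `2 * (K + δ)` per unit, which `hθ`
    -- bounds by `δ`.
    have hNi : ∫⁻ p, (ENNReal.ofReal (3 * δ) + N.indicator (fun _ => C) p) ∂γ ≤
        ENNReal.ofReal (3 * δ) + ENNReal.ofReal δ := by
      rw [lintegral_add_left' aemeasurable_const, lintegral_const, measure_univ, mul_one,
        lintegral_indicator_const hN]
      refine add_le_add le_rfl ((mul_le_mul' le_rfl (hγ.trans hsum)).trans ?_)
      rw [hC, ← ENNReal.ofReal_mul (by positivity)]
      exact ENNReal.ofReal_le_ofReal (by linarith)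
    calc ∫⁻ p, ENNReal.ofReal (⨅ j, (T.dist p.1 (A.center j) + δ + S.dist (B.center j) p.2)) ∂γ
        ≤ ∫⁻ p, (f p.1 + (g p.2 + (ENNReal.ofReal (3 * δ) + N.indicator (fun _ => C) p))) ∂γ :=
          lintegral_mono fun p => ofReal_crossDist_le A B hδ hK p.1 p.2
      _ = ∫⁻ p, f p.1 ∂γ + (∫⁻ p, g p.2 ∂γ +
            ∫⁻ p, (ENNReal.ofReal (3 * δ) + N.indicator (fun _ => C) p) ∂γ) := by
          rw [lintegral_add_left' hfm', lintegral_add_left' hgm']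
      _ ≤ ENNReal.ofReal δ + (ENNReal.ofReal δ + (ENNReal.ofReal (3 * δ) + ENNReal.ofReal δ)) :=
          add_le_add hfi (add_le_add hgi hNi)
      _ = ENNReal.ofReal (6 * δ) := by
          rw [← ENNReal.ofReal_add (by positivity) hδ, ← ENNReal.ofReal_add hδ (by positivity),
            ← ENNReal.ofReal_add hδ (by positivity)]
          congr 1
          ring
  exact ⟨(hcross.distK_le hTa hSa h₁ h₂).trans key,
    (hcross.distM_le h₁ h₂ hm).trans (by gcongr)⟩

end

/-! ### Finite nets and the conclusion. -/

lemma exists_finite_net_of_bounded {I : Type v} {J : Type*} [Fintype J] (w : I → J → ℝ) {M : ℝ}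
    (hw : ∀ i j, |w i j| ≤ M) {η : ℝ} (hη : 0 < η) :
    ∃ F : Set I, F.Finite ∧ ∀ i, ∃ k ∈ F, ∀ j, |w i j - w k j| ≤ η := by
  have hb : Set.range w ⊆ Set.pi Set.univ fun _ => Set.Icc (-M) M := by
    rintro _ ⟨i, rfl⟩ j -
    exact abs_le.1 (hw i j)
  have htb : TotallyBounded (Set.range w) :=
    (isCompact_univ_pi fun _ => isCompact_Icc).totallyBounded.subset hb
  obtain ⟨t, htw, htf, ht⟩ := Metric.finite_approx_of_totallyBounded htb η hη
  choose g hg using fun z : t => htw z.2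
  have := htf.to_subtype
  refine ⟨Set.range g, Set.finite_range g, fun i => ?_⟩
  obtain ⟨z, hz, hiz⟩ := Set.mem_iUnion₂.1 (ht ⟨i, rfl⟩)
  refine ⟨g ⟨z, hz⟩, Set.mem_range_self _, fun j => ?_⟩
  rw [hg ⟨z, hz⟩, ← Real.dist_eq]
  exact (dist_le_pi_dist _ _ j).trans (Metric.mem_ball.1 hiz).le

lemma exists_finite_net {I : Type v} {T : I → SemimetricTriple.{u}}
    (hadm : ∀ i, (T i).Admissible) (hui : UniformlyIntegrableFamily T)
    (hent : UniformlyBoundedEntropy T) {ε : ℝ} (hε : 0 < ε) :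
    ∃ F : Set I, F.Finite ∧ ∀ i, ∃ k ∈ F,
      distM (T i) (T k) < ENNReal.ofReal ε ∧ distK (T i) (T k) < ENNReal.ofReal ε := by
  -- The bounds are `6 * δ` for `distK` and `12 * δ` for `distM`; `13` makes both strictly less than
  -- `ε`.
  set δ : ℝ := ε / 13 with hδdef
  have hδ : 0 < δ := by positivity
  obtain ⟨n, K, hK, hA⟩ := exists_nonempty_discretization hui hent hδ
  let A : ∀ i, Discretization (T i) n K δ := fun i => (hA i).some
  set θ : ℝ := δ / ((n + 1) * (2 * (K + δ))) with hθdef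
  have hθ : 0 < θ := by positivity
  -- The invariant of a discretization: distances between centers and masses of pieces, including
  -- the remainder.
  let w : I → (Fin (n + 1) × Fin (n + 1)) ⊕ Fin (n + 1) → ℝ := fun i => Sum.elim
    (fun jl => (T i).dist ((A i).center jl.1) ((A i).center jl.2))
    (fun j => (T i).measure.real ((A i).label ⁻¹' {j}))
  have hw : ∀ i j, |w i j| ≤ max K 1 := by
    rintro i (j | j)
    · refine le_max_of_le_left ?_
      simp only [w, Sum.elim_inl]
      rw [abs_of_nonneg ((T i).measurableSemimetric.semimetric.nonneg _ _)]
      exact (A i).dist_centers_le _ _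
    · refine le_max_of_le_right ?_
      simp only [w, Sum.elim_inr]
      rw [abs_of_nonneg measureReal_nonneg]
      exact measureReal_le_one
  obtain ⟨F, hF, hnet⟩ := exists_finite_net_of_bounded w hw (lt_min hδ hθ)
  refine ⟨F, hF, fun i => ?_⟩
  obtain ⟨k, hk, hik⟩ := hnet i
  have hpair := (A i).exists_crossDist_le (A k) (hadm i) (hadm k) hδ.le hK (θ := θ) (by
      rw [hθdef]
      refine le_of_eq ?_
      field_simp) (fun j l => ?_) (fun j => ?_)
  · refine ⟨k, hk, hpair.2.trans_lt ?_, hpair.1.trans_lt ?_⟩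
    · rw [show (2 : ℝ≥0∞) = ENNReal.ofReal 2 by simp, ← ENNReal.ofReal_mul (by norm_num),
        ENNReal.ofReal_lt_ofReal_iff hε]
      linarith
    · rw [ENNReal.ofReal_lt_ofReal_iff hε]
      linarith
  · exact (hik (.inl (j, l))).trans ((min_le_left _ _).trans (by linarith))
  · have h1 := (le_abs_self _).trans ((hik (.inr j)).trans (min_le_right _ _))
    have h2 : (T i).measure.real ((A i).label ⁻¹' {j}) ≤
        (T k).measure.real ((A k).label ⁻¹' {j}) + θ := by
      simp only [w, Sum.elim_inr] at h1
      linarith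
    rw [← ofReal_measureReal, ← ofReal_measureReal, ← ENNReal.ofReal_add measureReal_nonneg hθ.le]
    exact ENNReal.ofReal_le_ofReal h2

lemma isPrecompactFor_range {I S : Type*} {T : I → S} {d : S → S → ℝ≥0∞}
    (h : ∀ ε : ℝ, 0 < ε → ∃ F : Set I, F.Finite ∧ ∀ i, ∃ k ∈ F, d (T i) (T k) < ENNReal.ofReal ε) :
    IsPrecompactFor d (Set.range T) := by
  intro ε hε
  obtain ⟨F, hF, hnet⟩ := h ε hε
  refine ⟨T '' F, hF.image T, Set.image_subset_range _ _, ?_⟩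
  rintro _ ⟨i, rfl⟩
  obtain ⟨k, hk, hik⟩ := hnet i
  exact ⟨_, Set.mem_image_of_mem T hk, hik⟩

theorem mainTheorem4 {I : Type v} (T : I → SemimetricTriple.{u})
    (hadm : ∀ i, (T i).Admissible) (hsum : ∀ i, (T i).Summable) :
    (IsPrecompactFor distM (Set.range T) ↔
      UniformlyIntegrableFamily T ∧ UniformlyBoundedEntropy T) ∧
    (IsPrecompactFor distK (Set.range T) ↔
      UniformlyIntegrableFamily T ∧ UniformlyBoundedEntropy T) := by
  refine ⟨⟨fun h => h.conditions hadm hsum (fun i j c hc R => ?_) fun i j ε hε hlt k hk => ?_,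
    fun h => isPrecompactFor_range fun ε hε => ?_⟩,
    ⟨fun h => h.conditions hadm hsum (fun i j c hc R => ?_) fun i j ε hε hlt k hk => ?_,
    fun h => isPrecompactFor_range fun ε hε => ?_⟩⟩
  · refine (SemimetricTriple.tail_le_of_distM_lt hc R).trans ?_
    rw [two_mul]
    exact add_le_add_right le_self_add _
  · exact hk.of_distM_lt (hadm i) hε hlt
  · obtain ⟨F, hF, hnet⟩ := exists_finite_net hadm h.1 h.2 hε
    exact ⟨F, hF, fun i => (hnet i).imp fun k hk => ⟨hk.1, hk.2.1⟩⟩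
  · exact SemimetricTriple.tail_le_of_distK_lt (hadm i) (hadm j) hc R
  · exact hk.of_distK_lt (hadm i) (hadm j) hε hlt
  · obtain ⟨F, hF, hnet⟩ := exists_finite_net hadm h.1 h.2 hε
    exact ⟨F, hF, fun i => (hnet i).imp fun k hk => ⟨hk.1, hk.2.2⟩⟩
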